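/- All rings are associative and unital. A Sylvester matrix rank function on a ring $R$ is a map $\mathrm{rk}$ assigning a non-negative real number to every (rectangular) matrix over $R$ such that: (1) $\mathrm{rk}(A)=0$ for every zero matrix $A$, and $\mathrm{rk}(1)=1$; (2) $\mathrm{rk}(AB)\le \min\{\mathrm{rk}(A),\mathrm{rk}(B)\}$ whenever the product $AB$ is defined; (3) $\mathrm{rk}\begin{pmatrix} A&0\\0&B\end{pmatrix}=\mathrm{rk}(A)+\mathrm{rk}(B)$ for all matrices $A,B$; (4) $\mathrm{rk}\begin{pmatrix} A&C\\0&B\end{pmatrix}\ge\mathrm{rk}(A)+\mathrm{rk}(B)$ for all matrices $A,B,C$ of compatible sizes. Let $\mathbb P(R)$ denote the set of all Sylvester matrix rank functions on $R$. A ring homomorphism $\varphi:R\to S$ induces a map $\varphi^\sharp:\mathbb P(S)\to\mathbb P(R)$, $\varphi^\sharp(\mathrm{rk})(A)=\mathrm{rk}(\varphi(A))$, where $\varphi$ is applied entrywise to $A$. **Proposition.** Let $R$ be a simple artinian ring with center $Z(R)$, and let $\iota: Z(R)[t]\to R[t]$ be the inclusion of polynomial rings in a central variable $t$. Then $\iota^\sharp:\mathbb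 P(R[t])\to\mathbb P(Z(R)[t])$ is a bijection. In particular, for every Sylvester matrix rank function $\mathrm{rk}$ on $Z(R)[t]$ there is exactly one Sylvester matrix rank function $\mathrm{rk}'$ on $R[t]$ that extends it, that is, with $\mathrm{rk}'(\iota(A))=\mathrm{rk}(A)$ for every matrix $A$ over $Z(R)[t]$. -/

import Mathlib

open scoped Polynomial

/-- The matrix with blocks `A`, `C` in the first block row and `0`, `B` in the second block row,
with its rows and columns numbered by `Fin (m + p)` and `Fin (n + q)` in the usual order. -/
def upperBlock {R : Type*} [Ring R] {m n p q : ℕ}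
    (A : Matrix (Fin m) (Fin n) R) (C : Matrix (Fin m) (Fin q) R)
    (B : Matrix (Fin p) (Fin q) R) : Matrix (Fin (m + p)) (Fin (n + q)) R :=
  Matrix.reindex finSumFinEquiv finSumFinEquiv (Matrix.fromBlocks A C 0 B)

/-- A Sylvester matrix rank function on a (unital, associative) ring `R`: a non-negative real
number `rk A` for every matrix `A` over `R`. The type is the space `ℙ(R)` of all of them. -/
@[ext]
structure SylvesterMatrixRank (R : Type*) [Ring R] where
  /-- the rank of an `m × n` matrix -/
  rk : ∀ {m n : ℕ}, Matrix (Fin m) (Fin n) R → ℝ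
  nonneg : ∀ {m n : ℕ} (A : Matrix (Fin m) (Fin n) R), 0 ≤ rk A
  rk_zero : ∀ m n : ℕ, rk (0 : Matrix (Fin m) (Fin n) R) = 0
  rk_one : rk (1 : Matrix (Fin 1) (Fin 1) R) = 1
  rk_mul_le : ∀ {m n p : ℕ} (A : Matrix (Fin m) (Fin n) R) (B : Matrix (Fin n) (Fin p) R),
    rk (A * B) ≤ min (rk A) (rk B)
  rk_diag : ∀ {m n p q : ℕ} (A : Matrix (Fin m) (Fin n) R) (B : Matrix (Fin p) (Fin q) R),
    rk (upperBlock A 0 B) = rk A + rk B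
  rk_upper : ∀ {m n p q : ℕ} (A : Matrix (Fin m) (Fin n) R) (C : Matrix (Fin m) (Fin q) R)
    (B : Matrix (Fin p) (Fin q) R), rk A + rk B ≤ rk (upperBlock A C B)

theorem upperBlock_map {R S : Type*} [Ring R] [Ring S] (f : R →+* S) {m n p q : ℕ}
    (A : Matrix (Fin m) (Fin n) R) (C : Matrix (Fin m) (Fin q) R)
    (B : Matrix (Fin p) (Fin q) R) :
    (upperBlock A C B).map f = upperBlock (A.map f) (C.map f) (B.map f) := by
  have h : (Matrix.fromBlocks A C 0 B).map f
      = Matrix.fromBlocks (A.map f) (C.map f) 0 (B.map f) := by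
    rw [Matrix.fromBlocks_map, Matrix.map_zero _ (map_zero f)]
  rw [upperBlock, upperBlock, ← h]
  rfl

/-- The map `φ♯ : ℙ(S) → ℙ(R)` induced by a ring homomorphism `φ : R → S`,
`φ♯(rk)(A) = rk(φ(A))`, where `φ(A)` is obtained by applying `φ` to each entry. -/
def SylvesterMatrixRank.pullback {R S : Type*} [Ring R] [Ring S] (φ : R →+* S)
    (r : SylvesterMatrixRank S) : SylvesterMatrixRank R where
  rk A := r.rk (A.map φ)
  nonneg A := r.nonneg _
  rk_zero m n := by
    rw [Matrix.map_zero _ (map_zero φ)]; exact r.rk_zero m n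
  rk_one := by
    rw [Matrix.map_one _ (map_zero φ) (map_one φ)]; exact r.rk_one
  rk_mul_le A B := by
    rw [Matrix.map_mul]; exact r.rk_mul_le _ _
  rk_diag A B := by
    rw [upperBlock_map, Matrix.map_zero _ (map_zero φ)]; exact r.rk_diag _ _
  rk_upper A C B := by
    rw [upperBlock_map]; exact r.rk_upper _ _ _

/-- The inclusion `ι : Z(R)[t] → R[t]`, where `Z(R)` is the center of `R`. -/
noncomputable def centerPolynomialInclusion (R : Type*) [Ring R] :
    (Subring.center R)[X] →+* R[X] :=
  Polynomial.mapRingHom (Subring.center R).subtype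

/-! Injectivity. A rank function on `R[X]` is determined by its values at central elements, which
form `Z(R)[X]`. Since `R` is a matrix ring over a division ring `D`, matrix units carry the claim to
`D[X]` (`MatrixUnits.rk_eq_of_center`). There a matrix is associated to a diagonal one with entries
a₁, a₂, …, where central polynomials can be interposed: a₁ divides c₁, which divides a₂, and so on.
Hence the rank lies between ∑ rk(cᵢ) and rk(1) + ∑ rk(cᵢ). The error does not grow with the matrix,
so comparing two ranks on A ⊕ A ⊕ … forces equality (`rk_eq_of_bounded`). Only monotonicity under
products and additivity on diagonal sums enter, so the argument survives passage to a non-unital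
corner; `AdditiveMatrixRank` isolates these axioms.

Surjectivity. Let K be the field `Z(R)`. By the first half for K and coprime factorization, a rank
on `K[X]` is determined by its values at prime powers (`eq_of_primes`). For a prime p, the sequence
e ↦ 1 - rk(pᵉ) vanishes at 0 and is nondecreasing and concave, hence on an initial segment it is a
nonnegative combination of the sequences min(e, n+1)/(n+1). These come from the normalized length
over the artinian ring R[X]/(pⁿ⁺¹) (`exists_primaryRank`). Over finitely many primes the weights add
up to at most 1, because 1 - rk is additive on coprime products; the remaining weight goes to a rank
that is 1 on all nonzero central polynomials. The resulting convex combination has the right values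
at finitely many prime powers, and an ultrafilter limit has them at all. -/

/-! ### Matrices that factor through each other -/

/-- Two matrices, possibly of different sizes, each of which factors through the other. -/
def MatrixAssoc {S : Type*} [Ring S] {ι κ ι' κ' : Type} [Fintype ι] [Fintype κ] [Fintype ι']
    [Fintype κ'] (A : Matrix ι κ S) (B : Matrix ι' κ' S) : Prop :=
  (∃ (P : Matrix ι ι' S) (Q : Matrix κ' κ S), A = P * B * Q) ∧
    ∃ (P : Matrix ι' ι S) (Q : Matrix κ κ' S), B = P * A * Q

namespace MatrixAssoc

variable {S : Type*} [Ring S] {ι κ ι' κ' ι'' κ'' : Type} [Fintype ι] [Fintype κ] [Fintype ι']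
    [Fintype κ'] [Fintype ι''] [Fintype κ'']

theorem symm {A : Matrix ι κ S} {B : Matrix ι' κ' S} (h : MatrixAssoc A B) : MatrixAssoc B A :=
  ⟨h.2, h.1⟩

theorem trans {A : Matrix ι κ S} {B : Matrix ι' κ' S} {C : Matrix ι'' κ'' S}
    (h : MatrixAssoc A B) (h' : MatrixAssoc B C) : MatrixAssoc A C := by
  obtain ⟨⟨P, Q, rfl⟩, P₁, Q₁, h₁⟩ := h
  obtain ⟨⟨P', Q', h₂⟩, P₂, Q₂, h₃⟩ := h'
  refine ⟨⟨P * P', Q' * Q, by rw [h₂]; simp only [Matrix.mul_assoc]⟩, P₂ * P₁, Q₁ * Q₂, ?_⟩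
  conv_lhs => rw [h₃, h₁]
  simp only [Matrix.mul_assoc]

theorem submatrix (A : Matrix ι κ S) (e : ι' ≃ ι) (f : κ' ≃ κ) :
    MatrixAssoc (A.submatrix e f) A := by
  classical
  have key : ∀ {ι κ ι' κ' : Type} [Fintype ι] [Fintype κ] [Fintype ι'] [Fintype κ']
      (A : Matrix ι κ S) (e : ι' ≃ ι) (f : κ' ≃ κ), ∃ (P : Matrix ι' ι S) (Q : Matrix κ κ' S),
      A.submatrix e f = P * A * Q := by
    intro ι κ ι' κ' _ _ _ _ A e f
    classical
    refine ⟨(1 : Matrix ι ι S).submatrix e (Equiv.refl ι),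
      (1 : Matrix κ κ S).submatrix (Equiv.refl κ) f, ?_⟩
    ext i j
    simp [Matrix.mul_apply, Matrix.one_apply]
  refine ⟨key A e f, ?_⟩
  obtain ⟨P, Q, h⟩ := key (A.submatrix e f) e.symm f.symm
  exact ⟨P, Q, by simpa using h⟩

theorem mul_left {A : Matrix ι κ S} (P : Matrix ι' ι S) (P' : Matrix ι ι' S)
    [DecidableEq ι] (h : P' * P = 1) : MatrixAssoc (P * A) A := by
  classical
  exact ⟨⟨P, 1, by simp⟩, P', 1, by simp [← Matrix.mul_assoc, h]⟩

theorem mul_right {A : Matrix ι κ S} (Q : Matrix κ κ' S) (Q' : Matrix κ' κ S)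
    [DecidableEq κ] (h : Q * Q' = 1) : MatrixAssoc (A * Q) A := by
  classical
  exact ⟨⟨1, Q, by simp⟩, 1, Q', by simp [Matrix.mul_assoc, h]⟩

end MatrixAssoc

/-! ### Additive matrix ranks and amplification -/

/-- A real-valued function on matrices that does not increase under multiplication and is additive
on diagonal block sums. -/
structure AdditiveMatrixRank (S : Type*) [Ring S] where
  /-- the value at a matrix -/
  rk : ∀ {ι κ : Type} [Fintype ι] [Fintype κ], Matrix ι κ S → ℝ
  rk_zero : ∀ (ι κ : Type) [Fintype ι] [Fintype κ], rk (0 : Matrix ι κ S) = 0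
  rk_mul_mul_le : ∀ {ι κ ι' κ' : Type} [Fintype ι] [Fintype κ] [Fintype ι'] [Fintype κ']
    (P : Matrix ι' ι S) (A : Matrix ι κ S) (Q : Matrix κ κ' S), rk (P * A * Q) ≤ rk A
  rk_fromBlocks : ∀ {ι κ ι' κ' : Type} [Fintype ι] [Fintype κ] [Fintype ι'] [Fintype κ']
    (A : Matrix ι κ S) (B : Matrix ι' κ' S), rk (Matrix.fromBlocks A 0 0 B) = rk A + rk B

namespace AdditiveMatrixRank

variable {S : Type*} [Ring S] {ι κ ι' κ' : Type} [Fintype ι] [Fintype κ] [Fintype ι']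
    [Fintype κ'] (ρ : AdditiveMatrixRank S)

/-- The value at an element, viewed as a `1 × 1` matrix. -/
def elt (a : S) : ℝ := ρ.rk (Matrix.of fun _ _ => a : Matrix Unit Unit S)

theorem rk_congr {A : Matrix ι κ S} {B : Matrix ι' κ' S} (h : MatrixAssoc A B) :
    ρ.rk A = ρ.rk B := by
  obtain ⟨⟨P, Q, h₁⟩, P', Q', h₂⟩ := h
  refine le_antisymm ?_ ?_
  · rw [h₁]; exact ρ.rk_mul_mul_le _ _ _
  · rw [h₂]; exact ρ.rk_mul_mul_le _ _ _

theorem nonneg (A : Matrix ι κ S) : 0 ≤ ρ.rk A := by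
  have := ρ.rk_mul_mul_le (0 : Matrix ι ι S) A (0 : Matrix κ κ S)
  rwa [Matrix.mul_zero, ρ.rk_zero] at this

theorem elt_nonneg (a : S) : 0 ≤ ρ.elt a := ρ.nonneg _

theorem elt_zero : ρ.elt 0 = 0 := ρ.rk_zero Unit Unit

theorem elt_mul_mul_le (x a y : S) : ρ.elt (x * a * y) ≤ ρ.elt a := by
  have := ρ.rk_mul_mul_le (Matrix.of fun _ _ => x : Matrix Unit Unit S)
    (Matrix.of fun _ _ => a : Matrix Unit Unit S)
    (Matrix.of fun _ _ => y : Matrix Unit Unit S)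
  refine le_of_eq_of_le ?_ this
  unfold elt
  congr 1
  ext i j
  simp [Matrix.mul_apply]

theorem elt_mul_le_left (a y : S) : ρ.elt (a * y) ≤ ρ.elt a := by
  simpa using ρ.elt_mul_mul_le 1 a y

theorem elt_mul_le_right (x a : S) : ρ.elt (x * a) ≤ ρ.elt a := by
  simpa using ρ.elt_mul_mul_le x a 1

theorem rk_diagonal : ∀ (k : ℕ) (a : Fin k → S),
    ρ.rk (Matrix.diagonal a) = ∑ i, ρ.elt (a i) := by
  intro k
  induction k with
  | zero =>
    intro a
    rw [show Matrix.diagonal a = 0 from by ext i; exact i.elim0, ρ.rk_zero]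
    simp
  | succ k ih =>
    intro a
    rw [Fin.sum_univ_castSucc, ← ih, elt, ← ρ.rk_fromBlocks]
    refine ρ.rk_congr ?_
    have e : Matrix.fromBlocks (Matrix.diagonal fun i : Fin k => a i.castSucc) 0 0
        (Matrix.of fun _ _ => a (Fin.last k) : Matrix Unit Unit S)
        = (Matrix.diagonal a).submatrix
          (Sum.elim Fin.castSucc fun _ => Fin.last k) (Sum.elim Fin.castSucc fun _ => Fin.last k) := by
      ext i j
      rcases i with i | i <;> rcases j with j | j <;>
        simp [Matrix.diagonal_apply, Fin.castSucc_ne_last, (Fin.castSucc_ne_last _).symm]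
    have hb : Function.Bijective (Sum.elim Fin.castSucc fun _ => Fin.last k :
        Fin k ⊕ Unit → Fin (k + 1)) := by
      constructor
      · rintro (i | i) (j | j) h
        · simpa using h
        · exact absurd h (Fin.castSucc_ne_last _)
        · exact absurd h.symm (Fin.castSucc_ne_last _)
        · rfl
      · intro i
        refine Fin.lastCases ⟨Sum.inr (), rfl⟩ (fun i => ⟨Sum.inl i, rfl⟩) i
    rw [e]
    exact (MatrixAssoc.submatrix (Matrix.diagonal a) (Equiv.ofBijective _ hb)
      (Equiv.ofBijective _ hb)).symm

/-- Two functions that are uniformly close to each other coincide. -/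
theorem rk_eq_of_bounded {ρ₁ ρ₂ : AdditiveMatrixRank S} (C : ℝ)
    (h : ∀ {m n : ℕ} (A : Matrix (Fin m) (Fin n) S), |ρ₁.rk A - ρ₂.rk A| ≤ C)
    (A : Matrix ι κ S) : ρ₁.rk A = ρ₂.rk A := by
  have h' : ∀ {ι κ : Type} [Fintype ι] [Fintype κ] (A : Matrix ι κ S),
      |ρ₁.rk A - ρ₂.rk A| ≤ C := by
    intro ι κ _ _ A
    have e := MatrixAssoc.submatrix A (Fintype.equivFin ι).symm (Fintype.equivFin κ).symm
    rw [← ρ₁.rk_congr e, ← ρ₂.rk_congr e]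
    exact h _
  -- Replacing A by A ⊕ A doubles the difference, while the bound C stays the same.
  have key : ∀ (n : ℕ) {ι κ : Type} [Fintype ι] [Fintype κ] (A : Matrix ι κ S),
      2 ^ n * |ρ₁.rk A - ρ₂.rk A| ≤ C := by
    intro n
    induction n with
    | zero => intro ι κ _ _ A; simpa using h' A
    | succ n ih =>
      intro ι κ _ _ A
      have := ih (Matrix.fromBlocks A 0 0 A)
      rw [ρ₁.rk_fromBlocks, ρ₂.rk_fromBlocks,
        show ρ₁.rk A + ρ₁.rk A - (ρ₂.rk A + ρ₂.rk A) = 2 * (ρ₁.rk A - ρ₂.rk A) by ring,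
        abs_mul, abs_two] at this
      rw [pow_succ]
      linarith
  by_contra hne
  have hpos : 0 < |ρ₁.rk A - ρ₂.rk A| := abs_pos.2 (sub_ne_zero.2 hne)
  obtain ⟨n, hn⟩ := pow_unbounded_of_one_lt (C / |ρ₁.rk A - ρ₂.rk A|) (one_lt_two : (1 : ℝ) < 2)
  rw [div_lt_iff₀ hpos] at hn
  exact absurd (key n A) (not_le.2 hn)

end AdditiveMatrixRank

/-! ### Sylvester ranks as additive ranks -/

namespace SylvesterMatrixRank

variable {S : Type*} [Ring S] (r : SylvesterMatrixRank S)

theorem rk_mul_mul_le {m n p q : ℕ} (P : Matrix (Fin p) (Fin m) S) (A : Matrix (Fin m) (Fin n) S)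
    (Q : Matrix (Fin n) (Fin q) S) : r.rk (P * A * Q) ≤ r.rk A :=
  ((r.rk_mul_le _ _).trans (min_le_left _ _)).trans ((r.rk_mul_le _ _).trans (min_le_right _ _))

/-- A Sylvester matrix rank function, extended to matrices over arbitrary finite index types. -/
noncomputable def additive : AdditiveMatrixRank S where
  rk {ι κ} _ _ A := r.rk (A.submatrix (Fintype.equivFin ι).symm (Fintype.equivFin κ).symm)
  rk_zero ι κ := by
    intros
    rw [Matrix.submatrix_zero]
    exact r.rk_zero _ _
  rk_mul_mul_le {ι κ ι' κ'} _ _ _ _ P A Q := by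
    have : (P * A * Q).submatrix (Fintype.equivFin ι').symm (Fintype.equivFin κ').symm
        = P.submatrix (Fintype.equivFin ι').symm (Fintype.equivFin ι).symm
          * A.submatrix (Fintype.equivFin ι).symm (Fintype.equivFin κ).symm
          * Q.submatrix (Fintype.equivFin κ).symm (Fintype.equivFin κ').symm := by
      rw [Matrix.submatrix_mul_equiv, Matrix.submatrix_mul_equiv]
    rw [this]
    exact r.rk_mul_mul_le _ _ _
  rk_fromBlocks {ι κ ι' κ'} _ _ _ _ A B := by
    rw [← r.rk_diag]
    set A' := A.submatrix (Fintype.equivFin ι).symm (Fintype.equivFin κ).symm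
    set B' := B.submatrix (Fintype.equivFin ι').symm (Fintype.equivFin κ').symm
    have h : MatrixAssoc ((Matrix.fromBlocks A 0 0 B).submatrix
        (Fintype.equivFin (ι ⊕ ι')).symm (Fintype.equivFin (κ ⊕ κ')).symm) (upperBlock A' 0 B') := by
      refine (MatrixAssoc.submatrix _ _ _).trans ?_
      have e : Matrix.fromBlocks A' 0 0 B' = (Matrix.fromBlocks A 0 0 B).submatrix
          (Equiv.sumCongr (Fintype.equivFin ι).symm (Fintype.equivFin ι').symm)
          (Equiv.sumCongr (Fintype.equivFin κ).symm (Fintype.equivFin κ').symm) := by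
        ext i j
        rcases i with i | i <;> rcases j with j | j <;> simp [A', B']
      refine (MatrixAssoc.symm ?_).trans
        (MatrixAssoc.symm (MatrixAssoc.submatrix (Matrix.fromBlocks A' 0 0 B') _ _))
      rw [e]
      exact MatrixAssoc.submatrix _ _ _
    obtain ⟨⟨P, Q, h₁⟩, P', Q', h₂⟩ := h
    refine le_antisymm ?_ ?_
    · rw [h₁]; exact r.rk_mul_mul_le _ _ _
    · rw [h₂]; exact r.rk_mul_mul_le _ _ _

theorem additive_rk {m n : ℕ} (A : Matrix (Fin m) (Fin n) S) : r.additive.rk A = r.rk A := by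
  have h := MatrixAssoc.submatrix A
    ((finCongr (Fintype.card_fin m).symm).trans (Fintype.equivFin (Fin m)).symm)
    ((finCongr (Fintype.card_fin n).symm).trans (Fintype.equivFin (Fin n)).symm)
  have h' : MatrixAssoc (A.submatrix (Fintype.equivFin (Fin m)).symm
      (Fintype.equivFin (Fin n)).symm) A := MatrixAssoc.submatrix _ _ _
  obtain ⟨⟨P, Q, h₁⟩, P', Q', h₂⟩ := h'
  refine le_antisymm ?_ ?_
  · change r.rk (A.submatrix (Fintype.equivFin (Fin m)).symm (Fintype.equivFin (Fin n)).symm) ≤ _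
    rw [h₁]; exact r.rk_mul_mul_le _ _ _
  · change _ ≤ r.rk (A.submatrix (Fintype.equivFin (Fin m)).symm (Fintype.equivFin (Fin n)).symm)
    generalize A.submatrix (Fintype.equivFin (Fin m)).symm (Fintype.equivFin (Fin n)).symm = B at *
    rw [h₂]; exact r.rk_mul_mul_le _ _ _

theorem additive_elt (a : S) :
    r.additive.elt a = r.rk (Matrix.of fun _ _ => a : Matrix (Fin 1) (Fin 1) S) := by
  rw [← r.additive_rk]
  exact r.additive.rk_congr (MatrixAssoc.submatrix
    (Matrix.of fun _ _ => a : Matrix (Fin 1) (Fin 1) S) (Equiv.ofUnique Unit (Fin 1))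
    (Equiv.ofUnique Unit (Fin 1)))

theorem additive_elt_one : r.additive.elt 1 = 1 := by
  rw [additive_elt, ← r.rk_one]
  congr 1
  ext i j
  obtain rfl := Subsingleton.elim i j
  simp

theorem additive_elt_le_one (a : S) : r.additive.elt a ≤ 1 := by
  rw [← r.additive_elt_one]
  simpa using r.additive.elt_mul_le_left 1 a

end SylvesterMatrixRank

/-! ### Diagonal reduction over D[X] -/

namespace DivisionRingPolynomial

variable {D : Type*} [DivisionRing D]

/-- Scaling a by a constant on the right makes it monic without changing a D[X]. The degree bound
assumes r ≠ 0 because `natDegree` is 0 at the zero polynomial. -/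
theorem exists_eq_mul_add (x : D[X]) {a : D[X]} (ha : a ≠ 0) :
    ∃ q r : D[X], x = a * q + r ∧ (r ≠ 0 → r.natDegree < a.natDegree) := by
  have hl : a.leadingCoeff ≠ 0 := Polynomial.leadingCoeff_ne_zero.2 ha
  have hm : (a * Polynomial.C a.leadingCoeff⁻¹).Monic :=
    Polynomial.monic_mul_leadingCoeff_inv ha
  have hd : (a * Polynomial.C a.leadingCoeff⁻¹).degree = a.degree := by
    rw [Polynomial.degree_mul, Polynomial.degree_C (inv_ne_zero hl), add_zero]
  refine ⟨Polynomial.C a.leadingCoeff⁻¹ * (x /ₘ (a * Polynomial.C a.leadingCoeff⁻¹)),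
    x %ₘ (a * Polynomial.C a.leadingCoeff⁻¹), ?_, fun hr => ?_⟩
  · rw [← mul_assoc, add_comm]
    exact (Polynomial.modByMonic_add_div _ _).symm
  · refine Polynomial.natDegree_lt_natDegree hr ?_
    rw [← hd]
    exact Polynomial.degree_modByMonic_lt _ hm

/-- The opposite ring of D[X] is the polynomial ring over the opposite of D, which exchanges the two
sides. -/
theorem exists_eq_mul_add' (x : D[X]) {a : D[X]} (ha : a ≠ 0) :
    ∃ q r : D[X], x = q * a + r ∧ (r ≠ 0 → r.natDegree < a.natDegree) := by
  let e := Polynomial.opRingEquiv D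
  have hdeg : ∀ y : D[X], (e (MulOpposite.op y)).natDegree = y.natDegree := fun y => by
    simp [e]
  have hne : e (MulOpposite.op a) ≠ 0 := by simpa using ha
  obtain ⟨q, r, h, hr⟩ := exists_eq_mul_add (e (MulOpposite.op x)) hne
  refine ⟨(e.symm q).unop, (e.symm r).unop, ?_, fun h0 => ?_⟩
  · apply MulOpposite.op_injective
    apply e.injective
    simpa using h
  · rw [← hdeg, ← hdeg]
    simp only [MulOpposite.op_unop, RingEquiv.apply_symm_apply]
    refine hr fun h1 => h0 ?_
    simp [h1]

/-- Every nonempty two-sided ideal is generated by a central polynomial. -/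
theorem exists_central_generator (J : D[X] → Prop) (h0 : J 0) (hadd : ∀ x y, J x → J y → J (x + y))
    (hl : ∀ s x, J x → J (s * x)) (hr : ∀ s x, J x → J (x * s)) :
    ∃ c ∈ Subring.center D[X], J c ∧ ∀ x, J x → ∃ y, x = c * y := by
  classical
  have hsub : ∀ x y, J x → J y → J (x - y) := fun x y hx hy => by
    have := hadd x (-1 * y) hx (hl _ _ hy)
    rwa [neg_one_mul, ← sub_eq_add_neg] at this
  by_cases hJ : ∃ x, J x ∧ x ≠ 0
  · have hex : ∃ d, ∃ x, J x ∧ x ≠ 0 ∧ x.natDegree = d := by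
      obtain ⟨x, hx, hx0⟩ := hJ
      exact ⟨_, x, hx, hx0, rfl⟩
    obtain ⟨x, hx, hx0, hxd⟩ := Nat.find_spec hex
    have hmin : ∀ y, J y → y ≠ 0 → x.natDegree ≤ y.natDegree := fun y hy hy0 => by
      rw [hxd]; exact Nat.find_min' hex ⟨y, hy, hy0, rfl⟩
    set c := x * Polynomial.C x.leadingCoeff⁻¹ with hc
    have hcm : c.Monic := Polynomial.monic_mul_leadingCoeff_inv hx0
    have hcJ : J c := hr _ _ hx
    have hcd : c.natDegree = x.natDegree := by
      rw [hc, Polynomial.natDegree_mul hx0, Polynomial.natDegree_C, add_zero]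
      simpa using hx0
    clear_value c
    -- The commutator of d with the monic c lies in J, and its leading terms cancel; minimality of
    -- the degree of c makes it vanish.
    have hC : ∀ d : D, Polynomial.C d * c = c * Polynomial.C d := by
      intro d
      by_contra hne
      have hd : d ≠ 0 := by rintro rfl; simp at hne
      have h1 := hmin _ (hsub _ _ (hl (Polynomial.C d) c hcJ) (hr (Polynomial.C d) c hcJ))
        (sub_ne_zero.2 hne)
      have h2 : (Polynomial.C d * c - c * Polynomial.C d).degree < (Polynomial.C d * c).degree := by
        refine Polynomial.degree_sub_lt_left ?_ ?_ ?_
        · rw [Polynomial.degree_mul, Polynomial.degree_mul, add_comm]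
        · exact mul_ne_zero (by simpa using hd) hcm.ne_zero
        · rw [Polynomial.leadingCoeff_mul, Polynomial.leadingCoeff_mul, hcm.leadingCoeff]; simp
      have h3 := Polynomial.natDegree_lt_natDegree (sub_ne_zero.2 hne) h2
      rw [Polynomial.natDegree_mul (by simpa using hd) hcm.ne_zero, Polynomial.natDegree_C,
        zero_add] at h3
      omega
    refine ⟨c, ?_, hcJ, fun y hy => ?_⟩
    · rw [Subring.mem_center_iff]
      intro s
      induction s using Polynomial.induction_on' with
      | add p q hp hq => rw [add_mul, mul_add, hp, hq]
      | monomial n d =>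
        rw [← Polynomial.C_mul_X_pow_eq_monomial, mul_assoc, Polynomial.X_pow_mul, ← mul_assoc, hC,
          mul_assoc]
    · obtain ⟨q, r, h, hrd⟩ := exists_eq_mul_add y hcm.ne_zero
      refine ⟨q, ?_⟩
      have hrJ : J r := by
        have := hsub _ _ hy (hr q c hcJ)
        rwa [h, add_sub_cancel_left] at this
      by_cases hr0 : r = 0
      · rw [h, hr0, add_zero]
      · have := hmin r hrJ hr0
        have := hrd hr0
        omega
  · push Not at hJ
    exact ⟨0, Subring.zero_mem _, h0, fun x hx => ⟨0, by rw [hJ x hx, zero_mul]⟩⟩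

section Pivot

variable {m n : ℕ}

open Matrix in
/-- A matrix whose corner entry has minimal degree among the matrices associated to `A`:
the corner divides its row. -/
theorem corner_dvd_row {ι κ : Type} [Fintype ι] [Fintype κ] [DecidableEq ι] [DecidableEq κ]
    {ι' κ' : Type} [Fintype ι'] [Fintype κ'] (A : Matrix ι' κ' D[X]) {a : D[X]} (ha : a ≠ 0)
    (hmin : ∀ M : Matrix (Unit ⊕ ι) (Unit ⊕ κ) D[X], MatrixAssoc M A → ∀ i j, M i j ≠ 0 →
      a.natDegree ≤ (M i j).natDegree)
    (x : Matrix Unit κ D[X]) (y : Matrix ι Unit D[X]) (B : Matrix ι κ D[X])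
    (h : MatrixAssoc (fromBlocks (of fun _ _ => a) x y B) A) :
    ∃ q : Matrix Unit κ D[X], x = (of fun _ _ => a : Matrix Unit Unit D[X]) * q := by
  choose q r hqr hr using fun j => exists_eq_mul_add (x () j) ha
  have hQ : fromBlocks (1 : Matrix Unit Unit D[X]) (of fun _ j => -q j) 0 (1 : Matrix κ κ D[X])
      * fromBlocks 1 (of fun _ j => q j) 0 1 = 1 := by
    rw [fromBlocks_multiply, ← fromBlocks_one]
    congr 1
    · simp
    · ext i j; simp
    · simp
    · simp
  have h' := (MatrixAssoc.mul_right (A := fromBlocks (of fun _ _ => a) x y B) _ _ hQ).trans h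
  refine ⟨of fun _ j => q j, ?_⟩
  ext i j
  have h1 := hmin _ h' (Sum.inl ()) (Sum.inr j)
  rw [fromBlocks_multiply, fromBlocks_apply₁₂] at h1
  simp only [Matrix.mul_one, Matrix.add_apply, Matrix.mul_apply, of_apply, Finset.univ_unique,
    Finset.sum_singleton, PUnit.default_eq_unit, hqr j, mul_neg, neg_add_cancel_left] at h1
  have h2 : r j = 0 := by
    by_contra hne
    have := h1 hne
    have := hr j hne
    omega
  rw [show i = () from rfl, hqr j, h2]
  simp [Matrix.mul_apply]

open Matrix in
theorem corner_dvd_col {ι κ : Type} [Fintype ι] [Fintype κ] [DecidableEq ι] [DecidableEq κ]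
    {ι' κ' : Type} [Fintype ι'] [Fintype κ'] (A : Matrix ι' κ' D[X]) {a : D[X]} (ha : a ≠ 0)
    (hmin : ∀ M : Matrix (Unit ⊕ ι) (Unit ⊕ κ) D[X], MatrixAssoc M A → ∀ i j, M i j ≠ 0 →
      a.natDegree ≤ (M i j).natDegree)
    (x : Matrix Unit κ D[X]) (y : Matrix ι Unit D[X]) (B : Matrix ι κ D[X])
    (h : MatrixAssoc (fromBlocks (of fun _ _ => a) x y B) A) :
    ∃ q : Matrix ι Unit D[X], y = q * (of fun _ _ => a : Matrix Unit Unit D[X]) := by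
  choose q r hqr hr using fun i => exists_eq_mul_add' (y i ()) ha
  have hP : fromBlocks (1 : Matrix Unit Unit D[X]) 0 (of fun i _ => q i) (1 : Matrix ι ι D[X])
      * fromBlocks 1 0 (of fun i _ => -q i) 1 = 1 := by
    rw [fromBlocks_multiply, ← fromBlocks_one]
    congr 1
    · simp
    · simp
    · ext i j; simp
    · simp
  have h' := (MatrixAssoc.mul_left (A := fromBlocks (of fun _ _ => a) x y B) _ _ hP).trans h
  refine ⟨of fun i _ => q i, ?_⟩
  ext i j
  have h1 := hmin _ h' (Sum.inr i) (Sum.inl ())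
  rw [fromBlocks_multiply, fromBlocks_apply₂₁] at h1
  simp only [Matrix.one_mul, Matrix.add_apply, Matrix.mul_apply, of_apply, Finset.univ_unique,
    Finset.sum_singleton, PUnit.default_eq_unit, hqr i, neg_mul, neg_add_cancel_left] at h1
  have h2 : r i = 0 := by
    by_contra hne
    have := h1 hne
    have := hr i hne
    omega
  rw [show j = () from rfl, hqr i, h2]
  simp [Matrix.mul_apply]

open Matrix in
/-- A nonzero matrix over `D[X]` is associated to a diagonal sum of a nonzero element `a` and a
matrix all of whose entries lie in two-sided ideals contained in `a D[X]`. -/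
theorem exists_pivot (A : Matrix (Fin (m + 1)) (Fin (n + 1)) D[X]) (hA : A ≠ 0) :
    ∃ (a : D[X]) (B : Matrix (Fin m) (Fin n) D[X]),
      MatrixAssoc (fromBlocks (of fun _ _ => a : Matrix Unit Unit D[X]) 0 0 B) A ∧
      ∀ i j s, ∃ y, s * B i j = a * y := by
  classical
  let corner (M : Matrix (Unit ⊕ Fin m) (Unit ⊕ Fin n) D[X]) : D[X] := M (Sum.inl ()) (Sum.inl ())
  -- Permuting rows and columns brings any entry to the corner, so a corner of minimal degree has
  -- minimal degree among all nonzero entries of all associated matrices.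
  have hcorner : ∀ M : Matrix (Unit ⊕ Fin m) (Unit ⊕ Fin n) D[X], MatrixAssoc M A →
      ∀ i j, ∃ M' : Matrix (Unit ⊕ Fin m) (Unit ⊕ Fin n) D[X], MatrixAssoc M' A ∧
        corner M' = M i j := fun M hM i j =>
    ⟨M.submatrix (Equiv.swap (Sum.inl ()) i) (Equiv.swap (Sum.inl ()) j),
      (MatrixAssoc.submatrix _ _ _).trans hM, by simp [corner]⟩
  have hex : ∃ d, ∃ M, MatrixAssoc M A ∧ corner M ≠ 0 ∧ (corner M).natDegree = d := by
    let e (k : ℕ) : Unit ⊕ Fin k ≃ Fin (k + 1) :=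
      (Equiv.sumComm _ _).trans
        (((Equiv.refl _).sumCongr (Equiv.ofUnique Unit (Fin 1))).trans finSumFinEquiv)
    obtain ⟨i, j, hij⟩ : ∃ i j, A i j ≠ 0 := by
      by_contra! h
      exact hA (by ext i j : 1; exact h i j)
    obtain ⟨M, hM, h⟩ := hcorner _ (MatrixAssoc.submatrix A (e m) (e n)) ((e m).symm i)
      ((e n).symm j)
    refine ⟨_, M, hM, ?_, rfl⟩
    rw [h]
    simpa using hij
  obtain ⟨M, hM, hM0, hMd⟩ := Nat.find_spec hex
  have hmin : ∀ N : Matrix (Unit ⊕ Fin m) (Unit ⊕ Fin n) D[X], MatrixAssoc N A → ∀ i j, N i j ≠ 0 →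
      (corner M).natDegree ≤ (N i j).natDegree := fun N hN i j hne => by
    obtain ⟨N', hN', h⟩ := hcorner N hN i j
    rw [hMd]
    exact Nat.find_min' hex ⟨N', hN', h ▸ hne, by rw [h]⟩
  generalize ha : corner M = a at *
  have hMb : M = fromBlocks (of fun _ _ => a) M.toBlocks₁₂ M.toBlocks₂₁ M.toBlocks₂₂ := by
    conv_lhs => rw [← fromBlocks_toBlocks M]
    congr 1
    ext i j : 1
    exact ha
  generalize M.toBlocks₁₂ = x at hMb
  generalize M.toBlocks₂₁ = y at hMb
  generalize M.toBlocks₂₂ = B₀ at hMb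
  subst hMb
  obtain ⟨q, rfl⟩ := corner_dvd_row A hM0 hmin _ _ _ hM
  obtain ⟨p, rfl⟩ := corner_dvd_col A hM0 hmin _ _ _ hM
  set α : Matrix Unit Unit D[X] := of fun _ _ => a with hα
  have hdiag : MatrixAssoc (fromBlocks α 0 0 (B₀ - p * α * q)) A := by
    have hP : fromBlocks (1 : Matrix Unit Unit D[X]) 0 p (1 : Matrix (Fin m) (Fin m) D[X])
        * fromBlocks 1 0 (-p) 1 = 1 := by
      rw [fromBlocks_multiply, ← fromBlocks_one]; simp
    have hQ : fromBlocks (1 : Matrix Unit Unit D[X]) (-q) 0 (1 : Matrix (Fin n) (Fin n) D[X])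
        * fromBlocks 1 q 0 1 = 1 := by
      rw [fromBlocks_multiply, ← fromBlocks_one]; simp
    have h1 := (MatrixAssoc.mul_left (A := fromBlocks α (α * q) (p * α) B₀) _ _ hP).trans hM
    have h2 := (MatrixAssoc.mul_right _ _ hQ).trans h1
    convert h2 using 1
    rw [fromBlocks_multiply, fromBlocks_multiply]
    congr 1 <;> simp [Matrix.mul_assoc, sub_eq_neg_add]
  generalize B₀ - p * α * q = B at hdiag
  refine ⟨a, B, hdiag, fun i j s => ?_⟩
  -- Adding s times row i of B to the first row keeps the corner a, which is still minimal; hence a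
  -- divides the new entries s * B i j.
  let u : Matrix Unit (Fin m) D[X] := of fun _ k => if k = i then s else 0
  have hP : fromBlocks (1 : Matrix Unit Unit D[X]) (-u) 0 (1 : Matrix (Fin m) (Fin m) D[X])
      * fromBlocks 1 u 0 1 = 1 := by
    rw [fromBlocks_multiply, ← fromBlocks_one]; simp
  have h1 := (MatrixAssoc.mul_left (A := fromBlocks α 0 0 B) _ _ hP).trans hdiag
  rw [fromBlocks_multiply] at h1
  simp only [Matrix.one_mul, Matrix.mul_zero, Matrix.zero_mul, add_zero, zero_add] at h1
  obtain ⟨q', hq'⟩ := corner_dvd_row A hM0 hmin _ _ _ h1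
  refine ⟨q' () j, ?_⟩
  have := congrFun (congrFun hq' ()) j
  simpa [Matrix.mul_apply, u, hα] using this

end Pivot

/-- The value of an additive matrix rank at a matrix over `D[X]` is determined, up to a bounded
error, by its values at central elements. -/
theorem exists_central_approximation : ∀ (m n : ℕ) (A : Matrix (Fin m) (Fin n) D[X]) (c₀ : D[X])
    (_ : c₀ ∈ Subring.center D[X]) (_ : ∀ i j, ∃ y, A i j = c₀ * y),
    ∃ L : List D[X], (∀ c ∈ L, c ∈ Subring.center D[X]) ∧ ∀ ρ : AdditiveMatrixRank D[X],
      (L.map ρ.elt).sum ≤ ρ.rk A ∧ ρ.rk A ≤ ρ.elt c₀ + (L.map ρ.elt).sum := by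
  intro m
  induction m with
  | zero =>
    intro n A c₀ _ _
    refine ⟨[], by simp, fun ρ => ?_⟩
    rw [show A = 0 from by ext i; exact i.elim0, ρ.rk_zero]
    simpa using ρ.elt_nonneg c₀
  | succ m ih =>
    intro n A c₀ hc hc₀
    by_cases hA : A = 0
    · refine ⟨[], by simp, fun ρ => ?_⟩
      rw [hA, ρ.rk_zero]
      simpa using ρ.elt_nonneg c₀
    · obtain _ | n := n
      · exact absurd (by ext i j; exact j.elim0) hA
      obtain ⟨a, B, hAB, hB⟩ := exists_pivot A hA
      -- The factor c₀ of A is central, so it moves past P and divides every entry of P * A * Q, in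
      -- particular a.
      obtain ⟨y₀, hy₀⟩ : ∃ y, a = c₀ * y := by
        obtain ⟨⟨P, Q, h⟩, -⟩ := hAB
        choose Y hY using hc₀
        have hAY : A = c₀ • Matrix.of Y := by
          ext i j : 1
          simpa using hY i j
        refine ⟨(P * Matrix.of Y * Q) (Sum.inl ()) (Sum.inl ()), ?_⟩
        have h1 := congrFun (congrFun h (Sum.inl ())) (Sum.inl ())
        have h2 : P * (c₀ • Matrix.of Y) = c₀ • (P * Matrix.of Y) := by
          ext i j : 1
          simp only [Matrix.mul_apply, Matrix.smul_apply, smul_eq_mul, Finset.mul_sum]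
          refine Finset.sum_congr rfl fun k _ => ?_
          rw [← mul_assoc, Subring.mem_center_iff.1 hc, mul_assoc]
        rw [hAY, h2, Matrix.smul_mul] at h1
        simpa using h1
      -- The ideal is the largest two-sided one inside a D[X]. Its central generator c is a multiple
      -- of a and divides every entry of B, so c takes the place of c₀ in the induction.
      obtain ⟨c, hcc, hcJ, hcB⟩ := exists_central_generator (fun b => ∀ s, ∃ y, s * b = a * y)
        (fun s => ⟨0, by simp⟩)
        (fun x y hx hy s => by
          obtain ⟨u, hu⟩ := hx s
          obtain ⟨v, hv⟩ := hy s
          exact ⟨u + v, by rw [mul_add, mul_add, hu, hv]⟩)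
        (fun t x hx s => by
          obtain ⟨u, hu⟩ := hx (s * t)
          exact ⟨u, by rw [← mul_assoc, hu]⟩)
        (fun t x hx s => by
          obtain ⟨u, hu⟩ := hx s
          exact ⟨u * t, by rw [← mul_assoc, hu, mul_assoc]⟩)
      obtain ⟨L, hL, hLB⟩ := ih n B c hcc fun i j => hcB _ (hB i j)
      obtain ⟨y, hy⟩ := hcJ 1
      rw [one_mul] at hy
      -- The chain c₀ | a | c gives rk c ≤ rk a ≤ rk c₀; the slack rk c left for B is absorbed by
      -- the new list entry.
      refine ⟨c :: L, by simpa using ⟨hcc, hL⟩, fun ρ => ?_⟩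
      obtain ⟨h1, h2⟩ := hLB ρ
      have h3 : ρ.elt a ≤ ρ.elt c₀ := hy₀ ▸ ρ.elt_mul_le_left _ _
      have h4 : ρ.elt c ≤ ρ.elt a := hy ▸ ρ.elt_mul_le_left _ _
      have h5 : ρ.rk A = ρ.elt a + ρ.rk B := by
        rw [← ρ.rk_congr hAB, ρ.rk_fromBlocks, AdditiveMatrixRank.elt]
      rw [List.map_cons, List.sum_cons]
      constructor <;> linarith

/-- An additive matrix rank on `D[X]` is determined by its values at central elements. -/
theorem rk_eq_of_center {ρ₁ ρ₂ : AdditiveMatrixRank D[X]}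
    (h : ∀ c ∈ Subring.center D[X], ρ₁.elt c = ρ₂.elt c) {ι κ : Type} [Fintype ι] [Fintype κ]
    (A : Matrix ι κ D[X]) : ρ₁.rk A = ρ₂.rk A := by
  -- With c₀ = 1 the approximation applies to every matrix, with an error independent of its size.
  refine AdditiveMatrixRank.rk_eq_of_bounded (ρ₁.elt 1) (fun {m n} A => ?_) A
  obtain ⟨L, hL, hLA⟩ := exists_central_approximation m n A 1 (Subring.one_mem _)
    fun i j => ⟨A i j, (one_mul _).symm⟩
  have h1 := hLA ρ₁
  have h2 := hLA ρ₂
  rw [← h 1 (Subring.one_mem _), ← List.map_congr_left fun c hc => h c (hL c hc)] at h2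
  rw [abs_le]
  constructor <;> linarith [h1.1, h1.2, h2.1, h2.2]

end DivisionRingPolynomial

/-! ### Matrix units: from R[X] to D[X] -/

namespace AdditiveMatrixRank

/-- The additive matrix rank induced by a non-unital ring homomorphism. -/
def comap {S T : Type*} [Ring S] [Ring T] (ψ : S →ₙ+* T) (ρ : AdditiveMatrixRank T) :
    AdditiveMatrixRank S where
  rk A := ρ.rk (A.map ψ)
  rk_zero ι κ := by
    intros
    rw [Matrix.map_zero _ (map_zero ψ)]
    exact ρ.rk_zero ι κ
  rk_mul_mul_le P A Q := by
    have : (P * A * Q).map ψ = P.map ψ * A.map ψ * Q.map ψ := by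
      ext i j
      simp [Matrix.mul_apply, map_sum]
    rw [this]
    exact ρ.rk_mul_mul_le _ _ _
  rk_fromBlocks A B := by
    rw [Matrix.fromBlocks_map, Matrix.map_zero _ (map_zero ψ), Matrix.map_zero _ (map_zero ψ)]
    exact ρ.rk_fromBlocks _ _

end AdditiveMatrixRank

/-- A system of `k × k` matrix units in `T` commuting with the image of `j : S → T`, such that `S`
maps onto the corner ring. -/
structure MatrixUnits {S T : Type*} [Ring S] [Ring T] (j : S →+* T) (k : ℕ) [NeZero k] where
  /-- the matrix units -/
  E : Fin k → Fin k → T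
  mul_same : ∀ a b c, E a b * E b c = E a c
  mul_of_ne : ∀ a b c d, b ≠ c → E a b * E c d = 0
  sum_diag : ∑ a, E a a = 1
  comm : ∀ s a b, j s * E a b = E a b * j s
  corner : ∀ x a b, ∃ s, E 0 a * x * E b 0 = E 0 0 * j s

namespace MatrixUnits

variable {S T : Type*} [Ring S] [Ring T] {j : S →+* T} {k : ℕ} [NeZero k] (u : MatrixUnits j k)

/-- The map of `S` onto the corner ring. -/
def cornerHom : S →ₙ+* T where
  toFun s := u.E 0 0 * j s
  map_mul' s t := by
    rw [map_mul, mul_assoc (u.E 0 0), ← mul_assoc (j s), u.comm, mul_assoc (u.E 0 0) (j s),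
      ← mul_assoc (u.E 0 0) (u.E 0 0), u.mul_same]
  map_zero' := by simp
  map_add' s t := by simp [mul_add]

theorem cornerHom_apply (s : S) : u.cornerHom s = u.E 0 0 * j s := rfl

/-- In the Peirce decomposition of x each component is a product of matrix units and an element of
j(S), and j c commutes with all of these. -/
theorem map_mem_center (u : MatrixUnits j k) {c : S} (hc : c ∈ Subring.center S) :
    j c ∈ Subring.center T := by
  rw [Subring.mem_center_iff]
  intro x
  have hx : x = ∑ a, ∑ b, u.E a 0 * (u.E 0 a * x * u.E b 0) * u.E 0 b := by
    calc x = (∑ a, u.E a a) * x * ∑ b, u.E b b := by rw [u.sum_diag, one_mul, mul_one]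
      _ = ∑ a, ∑ b, u.E a a * x * u.E b b := by
        rw [Finset.sum_mul, Finset.sum_mul_sum]
      _ = _ := by
        refine Finset.sum_congr rfl fun a _ => Finset.sum_congr rfl fun b _ => ?_
        rw [← u.mul_same a 0 a, ← u.mul_same b 0 b]
        simp only [mul_assoc]
  have key : ∀ a b, Commute (j c) (u.E a 0 * (u.E 0 a * x * u.E b 0) * u.E 0 b) := by
    intro a b
    obtain ⟨s, hs⟩ := u.corner x a b
    have hE : ∀ a b, Commute (j c) (u.E a b) := fun a b => u.comm c a b
    have hj : Commute (j c) (j s) := by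
      rw [commute_iff_eq, ← map_mul, ← map_mul, Subring.mem_center_iff.1 hc]
    rw [hs]
    exact ((hE _ _).mul_right ((hE _ _).mul_right hj)).mul_right (hE _ _)
  rw [hx]
  exact (Commute.sum_right _ _ _ fun a _ => Commute.sum_right _ _ _ fun b _ => key a b).eq.symm

/-- The row (Eᵢ₀) and the column (E₀ᵢ) make j c associated to k diagonal copies of its corner
component. -/
theorem elt_center (ρ : AdditiveMatrixRank T) {c : S} (hc : c ∈ Subring.center S) :
    ρ.elt (j c) = k * ρ.elt (u.cornerHom c) := by
  have hcm := Subring.mem_center_iff.1 (u.map_mem_center hc)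
  have h : ρ.elt (j c) = ρ.rk (Matrix.diagonal fun _ : Fin k => u.cornerHom c) := by
    refine ρ.rk_congr ⟨⟨Matrix.of fun _ i => u.E i 0, Matrix.of fun i _ => u.E 0 i, ?_⟩,
      Matrix.of fun i _ => u.E 0 i, Matrix.of fun _ i => u.E i 0, ?_⟩
    · ext a b
      rw [Matrix.mul_apply]
      simp only [Matrix.mul_diagonal, Matrix.of_apply, cornerHom_apply]
      calc j c = (∑ i, u.E i i) * j c := by rw [u.sum_diag, one_mul]
        _ = _ := by
          rw [Finset.sum_mul]
          refine Finset.sum_congr rfl fun i _ => ?_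
          rw [← mul_assoc, u.mul_same, mul_assoc, ← hcm, ← mul_assoc, u.mul_same]
    · ext a b
      simp only [Matrix.mul_apply, Matrix.of_apply, cornerHom_apply, Finset.univ_unique,
        Finset.sum_singleton]
      rw [mul_assoc, ← hcm, ← mul_assoc]
      rcases eq_or_ne a b with rfl | hab
      · rw [u.mul_same, Matrix.diagonal_apply_eq]
      · rw [u.mul_of_ne _ _ _ _ hab, zero_mul, Matrix.diagonal_apply_ne _ hab]
  rw [h, ρ.rk_diagonal]
  simp

/-- Every matrix over `T` is associated to a matrix over the corner ring. -/
theorem exists_assoc {ι κ : Type} [Fintype ι] [Fintype κ] (A : Matrix ι κ T) :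
    ∃ B : Matrix (ι × Fin k) (κ × Fin k) S, MatrixAssoc A (B.map u.cornerHom) := by
  classical
  choose s hs using u.corner
  let B : Matrix (ι × Fin k) (κ × Fin k) S := Matrix.of fun p q => s (A p.1 q.1) p.2 q.2
  -- Cutting each row and column into k corner pieces loses nothing: U' * U = 1 because ∑ Eₐ₀E₀ₐ =
  -- 1.
  let U : Matrix (ι × Fin k) ι T := Matrix.of fun p i => if p.1 = i then u.E 0 p.2 else 0
  let U' (ι : Type) [DecidableEq ι] : Matrix ι (ι × Fin k) T :=
    Matrix.of fun i p => if i = p.1 then u.E p.2 0 else 0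
  let V : Matrix (κ × Fin k) κ T := Matrix.of fun p i => if p.1 = i then u.E 0 p.2 else 0
  have hB : B.map u.cornerHom = U * A * U' κ := by
    ext ⟨i, a⟩ ⟨l, b⟩
    simp only [Matrix.map_apply, B, Matrix.of_apply, cornerHom_apply, ← hs, Matrix.mul_apply, U, U',
      ite_mul, zero_mul, mul_ite, mul_zero, Finset.sum_ite_eq, Finset.mem_univ, if_true,
      Finset.sum_ite_eq']
  have hU : U' ι * U = 1 := by
    ext i l
    rw [Matrix.mul_apply, Fintype.sum_prod_type]
    simp only [U, U', Matrix.of_apply, ite_mul, zero_mul, mul_ite, mul_zero, u.mul_same]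
    rcases eq_or_ne i l with rfl | h
    · simp [u.sum_diag]
    · simp [Matrix.one_apply_ne h, h]
  have hV : U' κ * V = 1 := by
    ext i l
    rw [Matrix.mul_apply, Fintype.sum_prod_type]
    simp only [V, U', Matrix.of_apply, ite_mul, zero_mul, mul_ite, mul_zero, u.mul_same]
    rcases eq_or_ne i l with rfl | h
    · simp [u.sum_diag]
    · simp [Matrix.one_apply_ne h, h]
  refine ⟨B, ⟨U' ι, V, ?_⟩, U, U' κ, hB⟩
  rw [hB, ← Matrix.mul_assoc, ← Matrix.mul_assoc, hU, Matrix.one_mul, Matrix.mul_assoc, hV,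
    Matrix.mul_one]

end MatrixUnits

/-- Over a matrix ring of a polynomial ring over a division ring, an additive matrix rank is
determined by its values at central elements. -/
theorem MatrixUnits.rk_eq_of_center {D T : Type*} [DivisionRing D] [Ring T] {j : D[X] →+* T} {k : ℕ}
    [NeZero k] (u : MatrixUnits j k) {ρ₁ ρ₂ : AdditiveMatrixRank T}
    (h : ∀ c ∈ Subring.center T, ρ₁.elt c = ρ₂.elt c) {ι κ : Type} [Fintype ι] [Fintype κ]
    (A : Matrix ι κ T) : ρ₁.rk A = ρ₂.rk A := by
  obtain ⟨B, hB⟩ := u.exists_assoc A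
  rw [ρ₁.rk_congr hB, ρ₂.rk_congr hB]
  refine DivisionRingPolynomial.rk_eq_of_center (ρ₁ := ρ₁.comap u.cornerHom)
    (ρ₂ := ρ₂.comap u.cornerHom) (fun c hc => ?_) B
  have := h _ (u.map_mem_center hc)
  rw [u.elt_center ρ₁ hc, u.elt_center ρ₂ hc] at this
  exact mul_left_cancel₀ (by exact_mod_cast NeZero.ne k) this

/-- The standard matrix units in `R[X]` for a matrix ring `R` over `D`. -/
noncomputable def polynomialMatrixUnits {R D : Type*} [Ring R] [Ring D] {k : ℕ} [NeZero k]
    (e : R ≃+* Matrix (Fin k) (Fin k) D) :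
    MatrixUnits (Polynomial.mapRingHom ((e.symm : Matrix (Fin k) (Fin k) D →+* R).comp
      (Matrix.scalar (Fin k)))) k where
  E a b := Polynomial.C (e.symm (Matrix.single a b 1))
  mul_same a b c := by
    rw [← Polynomial.C_mul, ← map_mul, Matrix.single_mul_single_same, mul_one]
  mul_of_ne a b c d h := by
    rw [← Polynomial.C_mul, ← map_mul, Matrix.single_mul_single_of_ne _ _ _ _ h]; simp
  sum_diag := by
    rw [← map_sum, ← map_sum]
    have : ∑ a : Fin k, Matrix.single a a (1 : D) = 1 := by
      ext i l
      simp only [Matrix.sum_apply, Matrix.single_apply, Matrix.one_apply, ite_and,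
        Finset.sum_ite_eq', Finset.mem_univ, if_true]
    rw [this]; simp
  comm s a b := by
    induction s using Polynomial.induction_on' with
    | add p q hp hq => rw [map_add, add_mul, mul_add, hp, hq]
    | monomial n d =>
      rw [Polynomial.coe_mapRingHom, Polynomial.map_monomial, Polynomial.monomial_mul_C,
        Polynomial.C_mul_monomial]
      congr 1
      simp only [RingHom.comp_apply, RingHom.coe_coe, ← map_mul]
      congr 1
      ext i l
      simp [Matrix.mul_apply, Matrix.scalar_apply, Matrix.diagonal_apply, Matrix.single_apply,
        ite_and]
      split_ifs <;> simp_all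
  corner x a b := by
    induction x using Polynomial.induction_on' with
    | add p q hp hq =>
      obtain ⟨s, hs⟩ := hp
      obtain ⟨t, ht⟩ := hq
      exact ⟨s + t, by rw [mul_add, add_mul, hs, ht, map_add, mul_add]⟩
    | monomial n d =>
      refine ⟨Polynomial.monomial n (e d a b), ?_⟩
      rw [Polynomial.coe_mapRingHom, Polynomial.map_monomial, Polynomial.C_mul_monomial,
        Polynomial.monomial_mul_C, Polynomial.C_mul_monomial]
      congr 1
      apply e.injective
      simp only [RingHom.comp_apply, RingHom.coe_coe, map_mul, RingEquiv.apply_symm_apply]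
      ext i l
      simp [Matrix.mul_apply, Matrix.scalar_apply, Matrix.diagonal_apply, Matrix.single_apply,
        ite_and]
      split_ifs <;> simp_all

/-- A Sylvester matrix rank function on `R[X]`, for a simple artinian ring `R`, is determined by
its values at central elements. -/
theorem SylvesterMatrixRank.eq_of_center {R : Type*} [Ring R] [IsSimpleRing R] [IsArtinianRing R]
    {r₁ r₂ : SylvesterMatrixRank R[X]}
    (h : ∀ c ∈ Subring.center R[X], r₁.additive.elt c = r₂.additive.elt c) : r₁ = r₂ := by
  obtain ⟨k, _, D, _, ⟨e⟩⟩ := IsSimpleRing.exists_ringEquiv_matrix_divisionRing R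
  ext m n A
  rw [← r₁.additive_rk, ← r₂.additive_rk]
  exact (polynomialMatrixUnits e).rk_eq_of_center h A

/-! ### The length rank of an artinian ring -/

namespace ArtinianRank

section Length

variable {A : Type*} [Ring A] {M N P : Type*} [AddCommGroup M] [AddCommGroup N] [AddCommGroup P]
  [Module A M] [Module A N] [Module A P]

variable (A M) in
/-- The length of a module of finite length, as a natural number. -/
noncomputable def len : ℕ := (Module.length A M).toNat

theorem len_le_of_injective [IsArtinian A N] [IsNoetherian A N] (f : M →ₗ[A] N)
    (hf : Function.Injective f) : len A M ≤ len A N :=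
  ENat.toNat_le_toNat (Module.length_le_of_injective f hf) Module.length_ne_top

theorem len_le_of_surjective [IsArtinian A M] [IsNoetherian A M] (f : M →ₗ[A] N)
    (hf : Function.Surjective f) : len A N ≤ len A M :=
  ENat.toNat_le_toNat (Module.length_le_of_surjective f hf) Module.length_ne_top

theorem len_eq_add_of_exact [IsArtinian A M] [IsNoetherian A M] [IsArtinian A P]
    [IsNoetherian A P] (f : M →ₗ[A] N) (g : N →ₗ[A] P) (hf : Function.Injective f)
    (hg : Function.Surjective g) (h : Function.Exact f g) : len A N = len A M + len A P := by
  rw [len, Module.length_eq_add_of_exact f g hf hg h,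
    ENat.toNat_add Module.length_ne_top Module.length_ne_top]
  rfl

theorem len_pos [IsArtinian A M] [IsNoetherian A M] [Nontrivial M] : 0 < len A M :=
  Nat.pos_of_ne_zero fun h => by
    rcases (ENat.toNat_eq_zero).1 h with h | h
    · exact (Module.length_pos (R := A) (M := M)).ne' h
    · exact Module.length_ne_top h

end Length

variable {A : Type*} [Ring A]
variable {ι κ ι' κ' : Type*} [Fintype ι] [Fintype ι']

/-- The left submodule spanned by the rows of a matrix. -/
def rowSpace (M : Matrix ι κ A) : Submodule A (κ → A) := LinearMap.range M.vecMulLinear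

theorem mem_rowSpace {M : Matrix ι κ A} {w : κ → A} :
    w ∈ rowSpace M ↔ ∃ v, Matrix.vecMul v M = w := Iff.rfl

theorem mem_rowSpace_fromBlocks {M : Matrix ι κ A} {C : Matrix ι κ' A} {N : Matrix ι' κ' A}
    {w : κ ⊕ κ' → A} : w ∈ rowSpace (Matrix.fromBlocks M C 0 N) ↔
      ∃ u v, Sum.elim (Matrix.vecMul u M) (Matrix.vecMul u C + Matrix.vecMul v N) = w := by
  rw [mem_rowSpace]
  constructor
  · rintro ⟨v, rfl⟩
    exact ⟨v ∘ Sum.inl, v ∘ Sum.inr, by rw [Matrix.vecMul_fromBlocks]; simp⟩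
  · rintro ⟨u, v, rfl⟩
    exact ⟨Sum.elim u v, by rw [Matrix.vecMul_fromBlocks]; simp⟩

/-- The projection of the row space of a block matrix to that of its first block. -/
def rowProj (M : Matrix ι κ A) (C : Matrix ι κ' A) (N : Matrix ι' κ' A) :
    rowSpace (Matrix.fromBlocks M C 0 N) →ₗ[A] rowSpace M :=
  (LinearMap.funLeft A A Sum.inl).restrict fun w hw => by
    obtain ⟨u, v, rfl⟩ := mem_rowSpace_fromBlocks.1 hw
    exact ⟨u, rfl⟩

theorem rowProj_surjective (M : Matrix ι κ A) (C : Matrix ι κ' A) (N : Matrix ι' κ' A) :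
    Function.Surjective (rowProj M C N) := by
  rintro ⟨_, u, rfl⟩
  exact ⟨⟨_, mem_rowSpace_fromBlocks.2 ⟨u, 0, rfl⟩⟩, rfl⟩

/-- The inclusion of the row space of the last block into that of a block matrix. -/
def rowIncl (M : Matrix ι κ A) (C : Matrix ι κ' A) (N : Matrix ι' κ' A) :
    rowSpace N →ₗ[A] rowSpace (Matrix.fromBlocks M C 0 N) where
  toFun w := ⟨Sum.elim 0 w.1, by
    obtain ⟨v, hv⟩ := mem_rowSpace.1 w.2
    exact mem_rowSpace_fromBlocks.2 ⟨0, v, by simp [hv]⟩⟩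
  map_add' x y := by
    ext i
    rcases i with i | i <;> simp
  map_smul' a x := by
    ext i
    rcases i with i | i <;> simp

theorem rowIncl_injective (M : Matrix ι κ A) (C : Matrix ι κ' A) (N : Matrix ι' κ' A) :
    Function.Injective (rowIncl M C N) := fun x y h => by
  ext i
  exact congrFun (congrArg Subtype.val h) (Sum.inr i)

theorem exists_reindex {ι κ ι' κ' : Type*} [Fintype ι] [Fintype κ] [Fintype ι'] [Fintype κ']
    (M : Matrix ι κ A) (e : ι' ≃ ι) (f : κ' ≃ κ) :
    ∃ (P : Matrix ι' ι A) (Q : Matrix κ κ' A), M.submatrix e f = P * M * Q := by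
  classical
  refine ⟨(1 : Matrix ι ι A).submatrix e (Equiv.refl ι),
    (1 : Matrix κ κ A).submatrix (Equiv.refl κ) f, ?_⟩
  ext i j
  simp [Matrix.mul_apply, Matrix.one_apply]

variable [IsArtinianRing A] [Fintype κ]

/-- Left multiplication shrinks the row space, and right multiplication by Q is a left-linear map
onto the new row space. -/
theorem len_rowSpace_mul_mul_le (P : Matrix ι' ι A) (M : Matrix ι κ A) (Q : Matrix κ κ' A) :
    len A (rowSpace (P * M * Q)) ≤ len A (rowSpace M) := by
  have h1 : rowSpace (P * M) ≤ rowSpace M := by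
    rintro _ ⟨v, rfl⟩
    exact ⟨Matrix.vecMul v P, by simp⟩
  refine le_trans ?_ (len_le_of_injective _ (Submodule.inclusion_injective h1))
  refine len_le_of_surjective (Q.vecMulLinear.restrict (p := rowSpace (P * M))
    (q := rowSpace (P * M * Q)) ?_) ?_
  · rintro _ ⟨v, rfl⟩
    exact ⟨v, by simp⟩
  · rintro ⟨_, v, rfl⟩
    exact ⟨⟨Matrix.vecMul v (P * M), v, rfl⟩, Subtype.ext (by simp)⟩

theorem len_rowSpace_mul_le_left (M : Matrix ι κ A) (Q : Matrix κ κ' A) :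
    len A (rowSpace (M * Q)) ≤ len A (rowSpace M) := by
  classical
  have := len_rowSpace_mul_mul_le (1 : Matrix ι ι A) M Q
  rwa [Matrix.one_mul] at this

theorem len_rowSpace_mul_le_right (P : Matrix ι' ι A) (M : Matrix ι κ A) :
    len A (rowSpace (P * M)) ≤ len A (rowSpace M) := by
  classical
  have := len_rowSpace_mul_mul_le P M (1 : Matrix κ κ A)
  rwa [Matrix.mul_one] at this

variable [Fintype κ']

theorem len_rowSpace_congr {M : Matrix ι κ A} {N : Matrix ι' κ' A}
    {P : Matrix ι ι' A} {Q : Matrix κ' κ A} (h : M = P * N * Q)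
    {P' : Matrix ι' ι A} {Q' : Matrix κ κ' A} (h' : N = P' * M * Q') :
    len A (rowSpace M) = len A (rowSpace N) := by
  apply le_antisymm
  · rw [h]; exact len_rowSpace_mul_mul_le _ _ _
  · rw [h']; exact len_rowSpace_mul_mul_le _ _ _

/-- Projecting to the first block has image the row space of M, and its kernel contains a copy of
the row space of N. -/
theorem len_rowSpace_upper (M : Matrix ι κ A) (C : Matrix ι κ' A) (N : Matrix ι' κ' A) :
    len A (rowSpace M) + len A (rowSpace N)
      ≤ len A (rowSpace (Matrix.fromBlocks M C 0 N)) := by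
  have h := len_eq_add_of_exact (M := LinearMap.ker (rowProj M C N))
    (LinearMap.ker (rowProj M C N)).subtype (rowProj M C N) (Submodule.subtype_injective _)
    (rowProj_surjective M C N) (LinearMap.exact_subtype_ker_map (rowProj M C N))
  rw [h, add_comm]
  refine Nat.add_le_add_right (len_le_of_injective ((rowIncl M C N).codRestrict _ fun w => ?_) ?_) _
  · rw [LinearMap.mem_ker]
    rfl
  · intro x y h
    exact rowIncl_injective M C N (congrArg Subtype.val h)

/-- When C = 0 the kernel of the projection is exactly the copy of the row space of N. -/
theorem len_rowSpace_diag (M : Matrix ι κ A) (N : Matrix ι' κ' A) :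
    len A (rowSpace (Matrix.fromBlocks M 0 0 N)) = len A (rowSpace M) + len A (rowSpace N) := by
  rw [add_comm]
  refine len_eq_add_of_exact (rowIncl M 0 N) (rowProj M 0 N) (rowIncl_injective M 0 N)
    (rowProj_surjective M 0 N) fun w => ⟨fun h => ?_, ?_⟩
  · obtain ⟨u, v, hw⟩ := mem_rowSpace_fromBlocks.1 w.2
    refine ⟨⟨_, v, rfl⟩, Subtype.ext ?_⟩
    have hu : Matrix.vecMul u M = 0 := by
      have := congrArg Subtype.val h
      funext i
      have h2 := congrFun this i
      have h3 := congrFun hw (Sum.inl i)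
      exact h3.trans h2
    rw [← hw, hu]
    simp [rowIncl]
  · rintro ⟨x, rfl⟩
    rfl

theorem len_rowSpace_reindex (M : Matrix ι κ A) (e : ι ≃ ι') (f : κ ≃ κ') :
    len A (rowSpace (Matrix.reindex e f M)) = len A (rowSpace M) := by
  obtain ⟨P, Q, h⟩ := exists_reindex M e.symm f.symm
  obtain ⟨P', Q', h'⟩ := exists_reindex (Matrix.reindex e f M) e f
  refine len_rowSpace_congr h (P' := P') (Q' := Q') ?_
  rw [← h']
  ext i j
  simp

theorem len_rowSpace_of_elt (a : A) :
    len A (rowSpace (Matrix.of fun _ _ => a : Matrix (Fin 1) (Fin 1) A))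
      = len A (Ideal.span {a} : Ideal A) := by
  have hmem : ∀ w : Fin 1 → A,
      w ∈ rowSpace (Matrix.of fun _ _ => a : Matrix (Fin 1) (Fin 1) A) ↔ w 0 ∈ Ideal.span {a} := by
    intro w
    rw [Ideal.mem_span_singleton', mem_rowSpace]
    constructor
    · rintro ⟨v, rfl⟩
      exact ⟨v 0, by simp [Matrix.vecMul, dotProduct]⟩
    · rintro ⟨x, hx⟩
      refine ⟨fun _ => x, ?_⟩
      funext i
      obtain rfl := Subsingleton.elim 0 i
      simp [Matrix.vecMul, dotProduct, hx]
  refine le_antisymm (len_le_of_injective ((LinearMap.proj 0).restrict fun w hw => (hmem w).1 hw) ?_)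
    (len_le_of_surjective ((LinearMap.proj 0).restrict fun w hw => (hmem w).1 hw) ?_)
  · intro x y h
    ext i
    obtain rfl := Subsingleton.elim 0 i
    exact congrArg Subtype.val h
  · rintro ⟨x, hx⟩
    exact ⟨⟨fun _ => x, (hmem _).2 hx⟩, rfl⟩

variable (A) in
/-- The Sylvester matrix rank function of an artinian ring given by the normalized length of the
row space. -/
noncomputable def lengthRank [Nontrivial A] : SylvesterMatrixRank A where
  rk M := len A (rowSpace M) / len A A
  nonneg M := by positivity
  rk_zero m n := by
    have h : rowSpace (0 : Matrix (Fin m) (Fin n) A) = ⊥ := by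
      rw [eq_bot_iff]
      rintro _ ⟨v, rfl⟩
      simp
    rw [h, len]
    simp
  rk_one := by
    have h : (1 : Matrix (Fin 1) (Fin 1) A) = Matrix.of fun _ _ => 1 := by
      ext i j
      obtain rfl := Subsingleton.elim i j
      simp
    rw [h, len_rowSpace_of_elt, Ideal.span_singleton_one, len, len, Module.length_top]
    exact div_self (by exact_mod_cast (len_pos (A := A) (M := A)).ne')
  rk_mul_le M N := by
    refine le_min (div_le_div_of_nonneg_right ?_ (Nat.cast_nonneg _))
      (div_le_div_of_nonneg_right ?_ (Nat.cast_nonneg _))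
    · exact_mod_cast len_rowSpace_mul_le_left M N
    · exact_mod_cast len_rowSpace_mul_le_right M N
  rk_diag M N := by
    rw [upperBlock, len_rowSpace_reindex, len_rowSpace_diag]
    push_cast
    ring
  rk_upper M C N := by
    rw [upperBlock, len_rowSpace_reindex, ← add_div]
    gcongr
    exact_mod_cast len_rowSpace_upper M C N

theorem lengthRank_elt [Nontrivial A] (a : A) :
    (lengthRank A).additive.elt a = len A (Ideal.span {a} : Ideal A) / len A A := by
  rw [SylvesterMatrixRank.additive_elt, ← len_rowSpace_of_elt]
  rfl

/-- The normalized length rank of a power of a nilpotent element with exact powers. -/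
theorem lengthRank_elt_pow [Nontrivial A] {π : A} {n : ℕ}
    (hn : π ^ (n + 1) = 0) (hann : ∀ x, x * π = 0 → ∃ y, x = y * π ^ n) {e : ℕ} (he : e ≤ n + 1) :
    (lengthRank A).additive.elt (π ^ e) = 1 - e / (n + 1) := by
  -- Right multiplication by π maps Aπᵉ onto Aπᵉ⁺¹ with kernel Aπⁿ, so every step loses the same
  -- length; at e = n + 1 nothing is left.
  have step : ∀ e, e ≤ n → len A (Ideal.span {π ^ e} : Ideal A)
      = len A (Ideal.span {π ^ n} : Ideal A) + len A (Ideal.span {π ^ (e + 1)} : Ideal A) := by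
    intro e he
    have hle : (Ideal.span {π ^ n} : Ideal A) ≤ Ideal.span {π ^ e} := by
      rw [Ideal.span_singleton_le_iff_mem, Ideal.mem_span_singleton']
      exact ⟨π ^ (n - e), by rw [← pow_add, Nat.sub_add_cancel he]⟩
    refine len_eq_add_of_exact (Submodule.inclusion hle)
      ((LinearMap.toSpanSingleton A A π).restrict (p := Ideal.span {π ^ e})
        (q := Ideal.span {π ^ (e + 1)}) ?_) (Submodule.inclusion_injective hle) ?_ ?_
    · intro x hx
      obtain ⟨y, rfl⟩ := Ideal.mem_span_singleton'.1 hx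
      exact Ideal.mem_span_singleton'.2 ⟨y, by simp [pow_succ, mul_assoc]⟩
    · rintro ⟨x, hx⟩
      obtain ⟨y, rfl⟩ := Ideal.mem_span_singleton'.1 hx
      exact ⟨⟨y * π ^ e, Ideal.mem_span_singleton'.2 ⟨y, rfl⟩⟩,
        Subtype.ext (by simp [pow_succ, mul_assoc])⟩
    · rintro ⟨x, hx⟩
      constructor
      · intro h
        have h1 : x * π = 0 := by simpa using congrArg Subtype.val h
        obtain ⟨y, hy⟩ := hann x h1
        exact ⟨⟨x, Ideal.mem_span_singleton'.2 ⟨y, hy.symm⟩⟩, rfl⟩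
      · rintro ⟨⟨z, hz⟩, h⟩
        obtain ⟨y, rfl⟩ := Ideal.mem_span_singleton'.1 hz
        have h1 : y * π ^ n = x := congrArg Subtype.val h
        refine Subtype.ext ?_
        change x * π = 0
        rw [← h1, mul_assoc, ← pow_succ, hn, mul_zero]
  have key : ∀ e, e ≤ n + 1 → len A (Ideal.span {π ^ e} : Ideal A) + e *
      len A (Ideal.span {π ^ n} : Ideal A) = len A A := by
    intro e
    induction e with
    | zero =>
      intro _
      rw [pow_zero, Ideal.span_singleton_one, len, len, Module.length_top]
      simp [len]
    | succ e ih =>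
      intro he
      rw [← ih (by omega), step e (by omega)]
      ring
  have h0 : len A (Ideal.span {π ^ (n + 1)} : Ideal A) = 0 := by
    rw [hn, Ideal.span_singleton_zero, len]
    simp
  have h1 := key (n + 1) le_rfl
  have h2 := key e he
  rw [h0, zero_add] at h1
  have hpos : (0 : ℝ) < len A A := by exact_mod_cast len_pos (A := A) (M := A)
  have h1' : ((n : ℝ) + 1) * len A (Ideal.span {π ^ n} : Ideal A) = len A A := by exact_mod_cast h1
  have h2' : (len A (Ideal.span {π ^ e} : Ideal A) : ℝ) + e * len A (Ideal.span {π ^ n} : Ideal A)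
      = len A A := by exact_mod_cast h2
  rw [lengthRank_elt]
  have hn1 : (n : ℝ) + 1 ≠ 0 := by positivity
  field_simp
  rw [← h1'] at h2' ⊢
  linear_combination ((n : ℝ) + 1) * h2'

end ArtinianRank

/-! ### Ranks from the quotients R[X]/(pⁿ⁺¹) -/

theorem SylvesterMatrixRank.pullback_elt {R S : Type*} [Ring R] [Ring S] (φ : R →+* S)
    (r : SylvesterMatrixRank S) (a : R) :
    (r.pullback φ).additive.elt a = r.additive.elt (φ a) := by
  rw [additive_elt, additive_elt]
  rfl

theorem Ideal.isTwoSided_span_singleton_of_mem_center {S : Type*} [Ring S] {q : S}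
    (hq : q ∈ Subring.center S) : (Ideal.span {q}).IsTwoSided :=
  ⟨fun {a} b ha => by
    obtain ⟨x, rfl⟩ := Ideal.mem_span_singleton'.1 ha
    exact Ideal.mem_span_singleton'.2 ⟨x * b, by
      rw [mul_assoc, mul_assoc, Subring.mem_center_iff.1 hq b]⟩⟩

theorem Polynomial.map_mem_center {K R : Type*} [CommRing K] [Ring R] {f : K →+* R}
    (hf : ∀ a, f a ∈ Subring.center R) (g : K[X]) : g.map f ∈ Subring.center R[X] := by
  rw [Subring.mem_center_iff]
  intro x
  change Commute x (g.map f)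
  induction g using Polynomial.induction_on' with
  | add p q hp hq => rw [Polynomial.map_add]; exact hp.add_right hq
  | monomial n a =>
    rw [Polynomial.map_monomial, ← Polynomial.C_mul_X_pow_eq_monomial]
    refine Commute.mul_right ?_ (Polynomial.commute_X_pow x n).symm
    induction x using Polynomial.induction_on' with
    | add p q hp hq => exact hp.add_left hq
    | monomial m b =>
      rw [commute_iff_eq, Polynomial.monomial_mul_C, Polynomial.C_mul_monomial,
        Subring.mem_center_iff.1 (hf a)]

/-- Remainders modulo q show that the quotient is a finite R-module, hence artinian over R and a
fortiori over itself. -/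
theorem Polynomial.isArtinianRing_quotient_span_monic {R : Type*} [Ring R] [IsArtinianRing R]
    {q : R[X]} (hq : q.Monic) (hc : q ∈ Subring.center R[X]) [(Ideal.span {q}).IsTwoSided] :
    IsArtinianRing (R[X] ⧸ Ideal.span {q}) := by
  nontriviality R
  let F : Polynomial.degreeLT R q.natDegree →ₗ[R] R[X] ⧸ Ideal.span {q} :=
    ((Submodule.mkQ (Ideal.span {q})).restrictScalars R).comp (Submodule.subtype _)
  have hF : Function.Surjective F := by
    intro y
    obtain ⟨x, rfl⟩ := Submodule.mkQ_surjective _ y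
    refine ⟨⟨x %ₘ q, ?_⟩, ?_⟩
    · rw [Polynomial.mem_degreeLT]
      exact (Polynomial.degree_modByMonic_lt x hq).trans_le Polynomial.degree_le_natDegree
    · change Submodule.mkQ (Ideal.span {q}) (x %ₘ q) = Submodule.mkQ (Ideal.span {q}) x
      rw [← sub_eq_zero, ← map_sub, Submodule.mkQ_apply, Submodule.Quotient.mk_eq_zero]
      refine Ideal.mem_span_singleton'.2 ⟨-(x /ₘ q), ?_⟩
      have h := Polynomial.modByMonic_add_div x q
      rw [Subring.mem_center_iff.1 hc, mul_neg]
      nth_rewrite 3 [← h]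
      abel
  have : Module.Finite R (R[X] ⧸ Ideal.span {q}) :=
    Module.Finite.of_surjective (F ∘ₗ (Polynomial.degreeLTEquiv R q.natDegree).symm.toLinearMap)
      (hF.comp (LinearEquiv.surjective _))
  exact isArtinian_of_tower R inferInstance

/-- The length rank of `R[X] / (p ^ (n + 1))`, pulled back to `R[X]`, for a monic irreducible
central `p`. -/
theorem exists_primaryRank {K R : Type*} [Field K] [Ring R] [Nontrivial R] [IsArtinianRing R]
    {f : K →+* R} (hf : ∀ a, f a ∈ Subring.center R) {p : K[X]} (hp : p.Monic)
    (hpi : Irreducible p) (n : ℕ) :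
    ∃ r : SylvesterMatrixRank R[X],
      (∀ e : ℕ, r.additive.elt ((p ^ e).map f) = 1 - ((min e (n + 1) : ℕ) : ℝ) / (n + 1)) ∧
      ∀ g : K[X], IsCoprime g p → r.additive.elt (g.map f) = 1 := by
  set q : R[X] := p.map f with hq
  have hqm : q.Monic := hp.map f
  have hqc : ∀ k, q ^ k ∈ Subring.center R[X] := fun k =>
    Subring.pow_mem _ (Polynomial.map_mem_center hf p) k
  have htwo : (Ideal.span {q ^ (n + 1)}).IsTwoSided :=
    Ideal.isTwoSided_span_singleton_of_mem_center (hqc _)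
  have hart : IsArtinianRing (R[X] ⧸ Ideal.span {q ^ (n + 1)}) :=
    Polynomial.isArtinianRing_quotient_span_monic (hqm.pow _) (hqc _)
  have hdeg : q.natDegree = p.natDegree := hp.natDegree_map f
  have hdpos : 0 < p.natDegree := hpi.natDegree_pos
  have hnt : Nontrivial (R[X] ⧸ Ideal.span {q ^ (n + 1)}) := by
    refine Ideal.Quotient.nontrivial_iff.2 fun h => ?_
    obtain ⟨x, hx⟩ := Ideal.mem_span_singleton'.1 ((Ideal.eq_top_iff_one _).1 h)
    have hx0 : x ≠ 0 := by rintro rfl; simp at hx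
    have h1 := (hqm.pow (n + 1)).natDegree_mul' hx0
    rw [← Subring.mem_center_iff.1 (hqc _), hx, Polynomial.natDegree_one, hqm.natDegree_pow,
      hdeg] at h1
    have : 0 < (n + 1) * p.natDegree := by positivity
    omega
  let mk := Ideal.Quotient.mk (Ideal.span {q ^ (n + 1)})
  have hzero : mk q ^ (n + 1) = 0 := by
    rw [← map_pow]
    exact Ideal.Quotient.eq_zero_iff_mem.2 (Ideal.mem_span_singleton_self _)
  refine ⟨(ArtinianRank.lengthRank _).pullback mk, fun e => ?_, fun g hg => ?_⟩
  · rw [SylvesterMatrixRank.pullback_elt, Polynomial.map_pow, map_pow]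
    rcases le_total e (n + 1) with he | he
    · rw [min_eq_left he]
      refine ArtinianRank.lengthRank_elt_pow hzero (fun x hx => ?_) he
      obtain ⟨x, rfl⟩ := Ideal.Quotient.mk_surjective x
      rw [← map_mul, Ideal.Quotient.eq_zero_iff_mem] at hx
      obtain ⟨y, hy⟩ := Ideal.mem_span_singleton'.1 hx
      refine ⟨mk y, ?_⟩
      -- Before passing to the quotient, x q = y qⁿ⁺¹, and the monic q can be cancelled.
      rw [pow_succ, ← mul_assoc] at hy
      rw [← hqm.isRegular.right hy, map_mul, map_pow]
    · have hz : mk (p.map f) ^ e = 0 := pow_eq_zero_of_le he hzero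
      rw [min_eq_right he, hz, AdditiveMatrixRank.elt_zero]
      push_cast
      rw [div_self (by positivity), sub_self]
  · rw [SylvesterMatrixRank.pullback_elt]
    refine le_antisymm (SylvesterMatrixRank.additive_elt_le_one _ _) ?_
    -- A polynomial coprime to p is invertible modulo pⁿ⁺¹, so it has full rank.
    obtain ⟨u, v, huv⟩ := hg.pow_right (n := n + 1)
    have h1 : mk (u.map f) * mk (g.map f) = 1 := by
      have h2 := congrArg (fun z => mk (Polynomial.map f z)) huv
      simp only [Polynomial.map_add, Polynomial.map_mul, Polynomial.map_pow, Polynomial.map_one,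
        map_add, map_mul, map_pow, map_one] at h2
      rw [← hq, hzero, mul_zero, add_zero] at h2
      exact h2
    rw [← SylvesterMatrixRank.additive_elt_one (ArtinianRank.lengthRank
      (R[X] ⧸ Ideal.span {q ^ (n + 1)})), ← h1]
    exact AdditiveMatrixRank.elt_mul_le_right _ _ _

/-! ### Limits and convex combinations -/

namespace SylvesterMatrixRank

open Filter Topology

section Limits

variable {S : Type*} [Ring S]

/-- This confines the values at a given matrix to a compact interval, as needed for limits along
ultrafilters. -/
theorem rk_le (r : SylvesterMatrixRank S) {m n : ℕ} (A : Matrix (Fin m) (Fin n) S) :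
    r.rk A ≤ m := by
  have h := r.additive.rk_diagonal m fun _ => 1
  rw [Finset.sum_congr rfl fun _ _ => r.additive_elt_one, Matrix.diagonal_one, r.additive_rk] at h
  have h' := (r.rk_mul_le (1 : Matrix (Fin m) (Fin m) S) A).trans (min_le_left _ _)
  rw [Matrix.one_mul, h] at h'
  simpa using h'

/-- Rank functions converge along ultrafilters. -/
theorem exists_tendsto {I : Type*} (U : Ultrafilter I) (r : I → SylvesterMatrixRank S) :
    ∃ r' : SylvesterMatrixRank S, ∀ {m n : ℕ} (A : Matrix (Fin m) (Fin n) S),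
      Tendsto (fun i => (r i).rk A) U (𝓝 (r'.rk A)) := by
  have hex : ∀ (m n : ℕ) (A : Matrix (Fin m) (Fin n) S), ∃ x,
      Tendsto (fun i => (r i).rk A) U (𝓝 x) := by
    intro m n A
    obtain ⟨x, -, hx⟩ := (isCompact_Icc (a := (0 : ℝ)) (b := m)).ultrafilter_le_nhds
      (U.map fun i => (r i).rk A) (by
        rw [Ultrafilter.coe_map, le_principal_iff]
        exact Filter.Eventually.of_forall (f := (U : Filter I)) fun i => ⟨(r i).nonneg A, (r i).rk_le A⟩)
    exact ⟨x, hx⟩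
  choose ℓ hℓ using hex
  refine ⟨{
    rk := fun {m n} A => ℓ m n A
    nonneg := fun A => ge_of_tendsto' (hℓ _ _ A) fun i => (r i).nonneg A
    rk_zero := fun m n => tendsto_nhds_unique (hℓ _ _ _) (by simp [rk_zero])
    rk_one := tendsto_nhds_unique (hℓ _ _ _) (by simp [rk_one])
    rk_mul_le := fun A B => le_min
      (le_of_tendsto_of_tendsto' (hℓ _ _ _) (hℓ _ _ _)
        fun i => ((r i).rk_mul_le A B).trans (min_le_left _ _))
      (le_of_tendsto_of_tendsto' (hℓ _ _ _) (hℓ _ _ _)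
        fun i => ((r i).rk_mul_le A B).trans (min_le_right _ _))
    rk_diag := fun A B => tendsto_nhds_unique (hℓ _ _ _)
      (((hℓ _ _ A).add (hℓ _ _ B)).congr fun i => ((r i).rk_diag A B).symm)
    rk_upper := fun A C B => le_of_tendsto_of_tendsto' ((hℓ _ _ A).add (hℓ _ _ B)) (hℓ _ _ _)
      fun i => (r i).rk_upper A C B }, fun A => hℓ _ _ A⟩

/-- A finite convex combination of rank functions. -/
def mix {I : Type*} (s : Finset I) (w : I → ℝ) (hw : ∀ i ∈ s, 0 ≤ w i) (hw1 : ∑ i ∈ s, w i = 1)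
    (r : I → SylvesterMatrixRank S) : SylvesterMatrixRank S where
  rk A := ∑ i ∈ s, w i * (r i).rk A
  nonneg A := Finset.sum_nonneg fun i hi => mul_nonneg (hw i hi) ((r i).nonneg A)
  rk_zero m n := by simp [rk_zero]
  rk_one := by simp [rk_one, hw1]
  rk_mul_le A B := le_min
    (Finset.sum_le_sum fun i hi => mul_le_mul_of_nonneg_left
      (((r i).rk_mul_le A B).trans (min_le_left _ _)) (hw i hi))
    (Finset.sum_le_sum fun i hi => mul_le_mul_of_nonneg_left
      (((r i).rk_mul_le A B).trans (min_le_right _ _)) (hw i hi))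
  rk_diag A B := by simp only [rk_diag, mul_add, Finset.sum_add_distrib]
  rk_upper A C B := by
    rw [← Finset.sum_add_distrib]
    refine Finset.sum_le_sum fun i hi => ?_
    rw [← mul_add]
    exact mul_le_mul_of_nonneg_left ((r i).rk_upper A C B) (hw i hi)

theorem mix_elt {I : Type*} {s : Finset I} {w : I → ℝ} (hw : ∀ i ∈ s, 0 ≤ w i)
    (hw1 : ∑ i ∈ s, w i = 1) (r : I → SylvesterMatrixRank S) (a : S) :
    (mix s w hw hw1 r).additive.elt a = ∑ i ∈ s, w i * (r i).additive.elt a := by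
  simp only [additive_elt]
  rfl

end Limits

/-! ### Inequalities over commutative rings -/

section Commutative

variable {S : Type*} [CommRing S] (r : SylvesterMatrixRank S)

theorem elt_add_elt_eq_rk (a b : S) :
    r.additive.elt a + r.additive.elt b = r.rk (!![a, 0; 0, b]) := by
  have h : !![a, 0; 0, b] = Matrix.diagonal ![a, b] := by
    ext i j
    fin_cases i <;> fin_cases j <;> rfl
  rw [← r.additive_rk, h, r.additive.rk_diagonal]
  simp

theorem elt_add_elt_le_rk (a b c : S) :
    r.additive.elt a + r.additive.elt b ≤ r.rk !![a, c; 0, b] := by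
  have h := r.rk_upper (Matrix.of fun _ _ => a : Matrix (Fin 1) (Fin 1) S)
    (Matrix.of fun _ _ => c) (Matrix.of fun _ _ => b : Matrix (Fin 1) (Fin 1) S)
  rw [← additive_elt, ← additive_elt] at h
  refine h.trans_eq ?_
  congr 1
  ext i j
  fin_cases i <;> fin_cases j <;> rfl

/-- The triangular matrix with diagonal (xp, xp) and corner x reduces to diag(x, xp²). With x a
power of p this makes e ↦ 1 - rk(pᵉ) concave; it is the one estimate that draws on the axiom for
block triangular matrices. -/
theorem two_mul_elt_le (x p : S) :
    2 * r.additive.elt (x * p) ≤ r.additive.elt x + r.additive.elt (x * p * p) := by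
  rw [elt_add_elt_eq_rk, two_mul]
  refine (r.elt_add_elt_le_rk (x * p) (x * p) x).trans ?_
  have h : !![x * p, x; 0, x * p]
      = !![1, 0; p, 1] * !![x, 0; 0, x * p * p] * !![p, 1; -1, 0] := by
    ext i j
    fin_cases i <;> fin_cases j <;> simp [Matrix.mul_apply, Fin.sum_univ_two] <;> ring
  rw [h]
  exact r.rk_mul_mul_le _ _ _

/-- A Bézout relation makes diag(a, b) and diag(1, ab) factor through each other. -/
theorem elt_add_elt_of_isCoprime {a b : S} (h : IsCoprime a b) :
    r.additive.elt a + r.additive.elt b = 1 + r.additive.elt (a * b) := by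
  obtain ⟨u, v, huv⟩ := h
  rw [← r.additive_elt_one, elt_add_elt_eq_rk, elt_add_elt_eq_rk]
  have h1 : !![1, 0; 0, a * b]
      = !![1, 1; -(v * b), u * a] * !![a, 0; 0, b] * !![u, -b; v, a] := by
    ext i j
    fin_cases i <;> fin_cases j <;> simp [Matrix.mul_apply, Fin.sum_univ_two]
    · linear_combination -huv
    · ring
    · ring
    · linear_combination (-(a * b)) * huv
  have h2 : !![a, 0; 0, b]
      = !![u * a, -1; v * b, 1] * !![1, 0; 0, a * b] * !![a, b; -v, u] := by
    ext i j
    fin_cases i <;> fin_cases j <;> simp [Matrix.mul_apply, Fin.sum_univ_two]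
    · linear_combination (-a) * huv
    · ring
    · ring
    · linear_combination (-b) * huv
  refine le_antisymm ?_ ?_
  · conv_lhs => rw [h2]
    exact r.rk_mul_mul_le _ _ _
  · conv_lhs => rw [h1]
    exact r.rk_mul_mul_le _ _ _

theorem sum_one_sub_elt {I : Type*} (s : Finset I) (a : I → S)
    (h : ∀ i ∈ s, ∀ j ∈ s, i ≠ j → IsCoprime (a i) (a j)) :
    ∑ i ∈ s, (1 - r.additive.elt (a i)) = 1 - r.additive.elt (∏ i ∈ s, a i) := by
  classical
  induction s using Finset.induction_on with
  | empty => simp [additive_elt_one]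
  | insert i s hi ih =>
    have hc : IsCoprime (a i) (∏ j ∈ s, a j) := IsCoprime.prod_right fun j hj =>
      h i (Finset.mem_insert_self _ _) j (Finset.mem_insert_of_mem hj) (by rintro rfl; exact hi hj)
    rw [Finset.sum_insert hi, Finset.prod_insert hi, ih fun j hj k hk =>
      h j (Finset.mem_insert_of_mem hj) k (Finset.mem_insert_of_mem hk)]
    linarith [r.elt_add_elt_of_isCoprime hc]

end Commutative

end SylvesterMatrixRank

/-! ### Decomposition of concave sequences -/

/-- A concave nondecreasing sequence vanishing at `0` is, on an initial segment, a nonnegative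
combination of truncated linear sequences. -/
theorem exists_weights_of_concave {g : ℕ → ℝ} (h0 : g 0 = 0) (hmono : ∀ n, g n ≤ g (n + 1))
    (hconc : ∀ n, g n + g (n + 2) ≤ 2 * g (n + 1)) (N : ℕ) :
    ∃ w : ℕ → ℝ, (∀ n, 0 ≤ w n) ∧ ∀ e ≤ N + 1,
      ∑ n ∈ Finset.range (N + 1), w n * (((min e (n + 1) : ℕ) : ℝ) / (n + 1)) = g e := by
  -- The increments, cut off to 0 after N. Concavity makes c nonnegative below N; at N itself this
  -- is monotonicity.
  let s : ℕ → ℝ := fun n => if n ≤ N then g (n + 1) - g n else 0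
  let c : ℕ → ℝ := fun n => s n - s (n + 1)
  have hc : ∀ n, 0 ≤ c n := by
    intro n
    simp only [c, s]
    split_ifs with h1 h2
    · linarith [hconc n]
    · linarith [hmono n]
    · omega
    · simp
  refine ⟨fun n => (n + 1) * c n, fun n => mul_nonneg (by positivity) (hc n), fun e => ?_⟩
  have hsimp : ∀ e, ∑ n ∈ Finset.range (N + 1), (((n : ℝ) + 1) * c n) *
      (((min e (n + 1) : ℕ) : ℝ) / (n + 1)) = ∑ n ∈ Finset.range (N + 1), c n * (min e (n + 1) : ℕ) :=
    fun e => Finset.sum_congr rfl fun n _ => by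
      have : (n : ℝ) + 1 ≠ 0 := by positivity
      field_simp
  rw [hsimp]
  induction e with
  | zero => simp [h0]
  | succ e ih =>
    intro he
    -- From e to e + 1, min(e, n+1) grows by 1 exactly when e ≤ n; the corresponding c n telescope
    -- to s e.
    have htail : ∑ n ∈ Finset.range (N + 1), (if e ≤ n then c n else 0) = g (e + 1) - g e := by
      rw [← Finset.sum_filter]
      have hf : (Finset.range (N + 1)).filter (e ≤ ·) = Finset.Ico e (N + 1) := by
        ext n; simp [and_comm]
      rw [hf, Finset.sum_Ico_eq_sum_range]
      have ht := Finset.sum_range_sub' (fun k => s (e + k)) (N + 1 - e)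
      have hN : s (e + (N + 1 - e)) = 0 := by
        simp only [s]; rw [if_neg (by omega)]
      have hE : s e = g (e + 1) - g e := by
        simp only [s]; rw [if_pos (by omega)]
      simp only [add_zero, hN, hE, sub_zero] at ht
      exact ht
    rw [show g (e + 1) = g e + (g (e + 1) - g e) by ring, ← htail, ← ih (by omega),
      ← Finset.sum_add_distrib]
    refine Finset.sum_congr rfl fun n _ => ?_
    split_ifs with h
    · rw [min_eq_left (by omega), min_eq_left (by omega)]
      push_cast
      ring
    · rw [min_eq_right (by omega), min_eq_right (by omega), add_zero]

/-! ### Extension from K[X] to R[X] -/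

namespace SylvesterMatrixRank

open Filter Topology

variable {K R : Type*} [Field K] [Ring R] [Nontrivial R] [IsArtinianRing R] {f : K →+* R}

/-- An ultrafilter finer than `l` has a limit rank, and limits that already exist along `l` are
preserved. -/
theorem exists_tendsto_elt {S I : Type*} [Ring S] (l : Filter I) [l.NeBot]
    (r : I → SylvesterMatrixRank S) :
    ∃ r' : SylvesterMatrixRank S, ∀ (a : S) (x : ℝ),
      Tendsto (fun i => (r i).additive.elt a) l (𝓝 x) → r'.additive.elt a = x := by
  obtain ⟨r', hr'⟩ := exists_tendsto (Ultrafilter.of l) r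
  refine ⟨r', fun a x hx => tendsto_nhds_unique ?_ (hx.mono_left (Ultrafilter.of_le l))⟩
  simp only [additive_elt]
  exact hr' _

/-- There is a rank function on `R[X]` at which all nonzero central polynomials are invertible. -/
theorem exists_genericRank (hf : ∀ a, f a ∈ Subring.center R) :
    ∃ r : SylvesterMatrixRank R[X], ∀ g : K[X], g ≠ 0 → r.additive.elt (g.map f) = 1 := by
  -- Any monic prime would do. Writing g = Xᵉh with h prime to X, the rank of g modulo Xⁿ⁺¹ is at
  -- least 1 - e/(n+1), which tends to 1.
  choose ρ hρ hρ' using exists_primaryRank hf (Polynomial.monic_X (R := K)) Polynomial.irreducible_X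
  obtain ⟨r, hr⟩ := exists_tendsto_elt atTop ρ
  refine ⟨r, fun g hg => hr _ _ ?_⟩
  obtain ⟨e, h, hXh, rfl⟩ := WfDvdMonoid.max_power_factor hg (Polynomial.irreducible_X (R := K))
  have hcop : IsCoprime Polynomial.X h := (Polynomial.irreducible_X.coprime_iff_not_dvd).2 hXh
  have hval : ∀ n, 1 - (e : ℝ) / (n + 1) ≤ (ρ n).additive.elt ((Polynomial.X ^ e * h).map f) := by
    intro n
    have h1 := ((ρ n).pullback (Polynomial.mapRingHom f)).elt_add_elt_of_isCoprime
      (hcop.pow_left (m := e))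
    simp only [pullback_elt, Polynomial.coe_mapRingHom] at h1
    rw [hρ, hρ' n h hcop.symm] at h1
    have h2 : ((min e (n + 1) : ℕ) : ℝ) / (n + 1) ≤ e / (n + 1) := by
      gcongr
      exact min_le_left _ _
    linarith
  refine tendsto_of_tendsto_of_tendsto_of_le_of_le ?_ tendsto_const_nhds hval
    fun n => (ρ n).additive_elt_le_one _
  have := (tendsto_one_div_add_atTop_nhds_zero_nat (𝕜 := ℝ)).const_mul (e : ℝ)
  simpa [div_eq_mul_inv] using (this.const_sub 1)

/-- The monic irreducible polynomials. -/
abbrev MonicPrime (K : Type*) [Field K] : Type _ := {p : K[X] // p.Monic ∧ Irreducible p}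

theorem MonicPrime.isCoprime {p q : MonicPrime K} (h : p ≠ q) : IsCoprime p.1 q.1 :=
  (p.2.2.coprime_iff_not_dvd).2 fun hd => h <| Subtype.ext <|
    Polynomial.eq_of_monic_of_associated p.2.1 q.2.1 (p.2.2.associated_of_dvd q.2.2 hd)

/-- A rank function on `K[X]` extends to `R[X]` as far as finitely many powers of finitely many
monic irreducible polynomials are concerned. -/
theorem exists_extension_on_finset (hf : ∀ a, f a ∈ Subring.center R) (r : SylvesterMatrixRank K[X])
    (F : Finset (MonicPrime K)) (N : ℕ) :
    ∃ r' : SylvesterMatrixRank R[X], ∀ p ∈ F, ∀ e ≤ N + 1,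
      r'.additive.elt ((p.1 ^ e).map f) = r.additive.elt (p.1 ^ e) := by
  classical
  obtain ⟨r₀, hr₀⟩ := exists_genericRank hf
  choose ρ hρ hρ' using fun p : MonicPrime K => exists_primaryRank hf p.2.1 p.2.2
  have hw : ∀ p : MonicPrime K, ∃ w : ℕ → ℝ, (∀ n, 0 ≤ w n) ∧ ∀ e ≤ N + 1,
      ∑ n ∈ Finset.range (N + 1), w n * (((min e (n + 1) : ℕ) : ℝ) / (n + 1))
        = 1 - r.additive.elt (p.1 ^ e) := by
    intro p
    refine exists_weights_of_concave (g := fun e => 1 - r.additive.elt (p.1 ^ e)) ?_ (fun n => ?_)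
      (fun n => ?_) N
    · simp [additive_elt_one]
    · have := r.additive.elt_mul_le_left (p.1 ^ n) p.1
      rw [← pow_succ] at this
      linarith
    · have := r.two_mul_elt_le (p.1 ^ n) p.1
      rw [← pow_succ, ← pow_succ] at this
      linarith
  choose w hw0 hwe using hw
  -- At e = N + 1 every factor min(e, n+1)/(n+1) equals 1.
  have hsum : ∀ p, ∑ n ∈ Finset.range (N + 1), w p n = 1 - r.additive.elt (p.1 ^ (N + 1)) := by
    intro p
    rw [← hwe p (N + 1) le_rfl]
    refine Finset.sum_congr rfl fun n hn => ?_
    rw [min_eq_right (by simpa [Nat.lt_succ_iff] using hn)]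
    push_cast
    rw [div_self (by positivity), mul_one]
  have hW : ∑ p ∈ F, ∑ n ∈ Finset.range (N + 1), w p n ≤ 1 := by
    rw [Finset.sum_congr rfl fun p _ => hsum p, r.sum_one_sub_elt F (fun p => p.1 ^ (N + 1))
      fun p _ q _ h => (MonicPrime.isCoprime h).pow]
    linarith [r.additive.elt_nonneg (∏ p ∈ F, p.1 ^ (N + 1))]
  let s : Finset (Option (MonicPrime K × ℕ)) := Finset.insertNone (F ×ˢ Finset.range (N + 1))
  -- The index `none` gives the leftover weight to the generic rank.
  let v : Option (MonicPrime K × ℕ) → ℝ := fun o =>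
    o.elim (1 - ∑ p ∈ F, ∑ n ∈ Finset.range (N + 1), w p n) fun x => w x.1 x.2
  let σ : Option (MonicPrime K × ℕ) → SylvesterMatrixRank R[X] := fun o =>
    o.elim r₀ fun x => ρ x.1 x.2
  have hv : ∀ o ∈ s, 0 ≤ v o := by
    rintro (_ | x) -
    · simpa [v] using hW
    · exact hw0 _ _
  have hv1 : ∑ o ∈ s, v o = 1 := by
    simp only [s, Finset.sum_insertNone, v, Option.elim_none, Option.elim_some,
      Finset.sum_product]
    ring
  refine ⟨mix s v hv hv1 σ, fun q hq e he => ?_⟩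
  rw [mix_elt]
  simp only [s, Finset.sum_insertNone, v, σ, Option.elim_none, Option.elim_some,
    Finset.sum_product]
  rw [hr₀ _ (pow_ne_zero _ q.2.1.ne_zero), mul_one]
  -- Ranks attached to primes other than q are 1 at qᵉ, so only those attached to q lower the total,
  -- by 1 - rk(qᵉ).
  have hin : ∀ p ∈ F, ∑ n ∈ Finset.range (N + 1), w p n * (ρ p n).additive.elt ((q.1 ^ e).map f)
      = ∑ n ∈ Finset.range (N + 1), w p n - if p = q then 1 - r.additive.elt (q.1 ^ e) else 0 := by
    intro p _
    split_ifs with h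
    · subst h
      rw [← hwe p e he, ← Finset.sum_sub_distrib]
      refine Finset.sum_congr rfl fun n _ => ?_
      rw [hρ]
      ring
    · rw [sub_zero]
      refine Finset.sum_congr rfl fun n _ => ?_
      rw [hρ' p n _ (MonicPrime.isCoprime (Ne.symm h)).pow_left, mul_one]
  rw [Finset.sum_congr rfl hin, Finset.sum_sub_distrib, Finset.sum_ite_eq' F q, if_pos hq]
  ring

/-- A rank function on `K[X]` extends to `R[X]` as far as prime powers are concerned. -/
theorem exists_extension_on_primes (hf : ∀ a, f a ∈ Subring.center R)
    (r : SylvesterMatrixRank K[X]) :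
    ∃ r' : SylvesterMatrixRank R[X], ∀ (p : MonicPrime K) (e : ℕ),
      r'.additive.elt ((p.1 ^ e).map f) = r.additive.elt (p.1 ^ e) := by
  classical
  choose ρ hρ using fun x : Finset (MonicPrime K) × ℕ => exists_extension_on_finset hf r x.1 x.2
  obtain ⟨r', hr'⟩ := exists_tendsto_elt atTop ρ
  refine ⟨r', fun p e => hr' _ _ (tendsto_const_nhds.congr' ?_)⟩
  filter_upwards [eventually_ge_atTop (({p}, e) : Finset (MonicPrime K) × ℕ)] with x hx
  exact (hρ x p (Finset.singleton_subset_iff.1 hx.1) e (Nat.le_succ_of_le hx.2)).symm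

/-- A rank function on `K[X]` is determined by its values at prime powers. -/
theorem eq_of_primes {r₁ r₂ : SylvesterMatrixRank K[X]}
    (h : ∀ (p : MonicPrime K) (e : ℕ), r₁.additive.elt (p.1 ^ e) = r₂.additive.elt (p.1 ^ e)) :
    r₁ = r₂ := by
  classical
  have hunit : ∀ (r : SylvesterMatrixRank K[X]) {x : K[X]} (_ : IsUnit x),
      r.additive.elt x = 1 := by
    intro r x hx
    refine le_antisymm (r.additive_elt_le_one x) ?_
    obtain ⟨y, hy⟩ := hx.exists_right_inv
    rw [← r.additive_elt_one, ← hy]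
    exact r.additive.elt_mul_le_left _ _
  -- The uniqueness half, applied with the field K as the simple artinian ring, reduces matrices to
  -- single polynomials.
  refine eq_of_center fun c hc => ?_
  clear hc
  induction c using UniqueFactorizationMonoid.induction_on_coprime with
  | h0 => rw [AdditiveMatrixRank.elt_zero, AdditiveMatrixRank.elt_zero]
  | h1 hx => rw [hunit r₁ hx, hunit r₂ hx]
  | @hpr p i hp =>
    have hassoc : ∀ (r : SylvesterMatrixRank K[X]) {x y : K[X]}, Associated x y →
        r.additive.elt x = r.additive.elt y := by
      intro r x y hxy
      obtain ⟨a, rfl⟩ := hxy.dvd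
      obtain ⟨b, hb⟩ := hxy.symm.dvd
      refine le_antisymm ?_ (r.additive.elt_mul_le_left _ _)
      conv_lhs => rw [hb]
      exact r.additive.elt_mul_le_left _ _
    have hn : Associated p (normalize p) := (normalize_associated p).symm
    have hm : (normalize p).Monic := Polynomial.monic_normalize hp.ne_zero
    rw [hassoc r₁ hn.pow_pow, hassoc r₂ hn.pow_pow]
    exact h ⟨normalize p, hm, hn.irreducible hp.irreducible⟩ i
  | hcp hxy hx hy =>
    have h1 := r₁.elt_add_elt_of_isCoprime hxy.isCoprime
    have h2 := r₂.elt_add_elt_of_isCoprime hxy.isCoprime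
    linarith

/-- Every rank function on `K[X]` extends to `R[X]`. -/
theorem pullback_mapRingHom_surjective (hf : ∀ a, f a ∈ Subring.center R) :
    Function.Surjective (pullback (Polynomial.mapRingHom f) :
      SylvesterMatrixRank R[X] → SylvesterMatrixRank K[X]) := by
  intro r
  obtain ⟨r', hr'⟩ := exists_extension_on_primes hf r
  refine ⟨r', eq_of_primes fun p e => ?_⟩
  rw [pullback_elt]
  exact hr' p e

/-- Commuting with constants forces the coefficients of a central polynomial into `Z(R)`, so the
pullback sees all central values. -/
theorem pullback_center_injective (R : Type*) [Ring R] [IsSimpleRing R] [IsArtinianRing R] :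
    Function.Injective (pullback (centerPolynomialInclusion R)) := by
  intro r₁ r₂ h
  refine eq_of_center fun c hc => ?_
  obtain ⟨g, rfl⟩ : ∃ g, centerPolynomialInclusion R g = c := by
    have hcoeff : c ∈ Polynomial.lifts (Subring.center R).subtype := by
      rw [Polynomial.lifts_iff_coeff_lifts]
      intro n
      refine ⟨⟨c.coeff n, Subring.mem_center_iff.2 fun x => ?_⟩, rfl⟩
      have := congrArg (fun q => Polynomial.coeff q n)
        (Subring.mem_center_iff.1 hc (Polynomial.C x))
      simpa using this
    obtain ⟨g, hg⟩ := hcoeff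
    exact ⟨g, hg⟩
  rw [← pullback_elt, ← pullback_elt, h]

theorem pullback_center_surjective (R : Type*) [Ring R] [IsSimpleRing R] [IsArtinianRing R] :
    Function.Surjective (pullback (centerPolynomialInclusion R)) := by
  let : Field (Subring.center R) := (IsSimpleRing.isField_center R).toField
  exact pullback_mapRingHom_surjective (f := (Subring.center R).subtype) fun a => a.2

end SylvesterMatrixRank

theorem mainTheorem4 (R : Type*) [Ring R] [IsSimpleRing R] [IsArtinianRing R] :
    Function.Bijective
      (SylvesterMatrixRank.pullback (centerPolynomialInclusion R) :
        SylvesterMatrixRank R[X] → SylvesterMatrixRank (Subring.center R)[X]) ∧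
    ∀ r : SylvesterMatrixRank (Subring.center R)[X],
      ∃! r' : SylvesterMatrixRank R[X],
        ∀ (m n : ℕ) (A : Matrix (Fin m) (Fin n) (Subring.center R)[X]),
          r'.rk (A.map (centerPolynomialInclusion R)) = r.rk A := by
  have hbij : Function.Bijective (SylvesterMatrixRank.pullback (centerPolynomialInclusion R)) :=
    ⟨SylvesterMatrixRank.pullback_center_injective R,
      SylvesterMatrixRank.pullback_center_surjective R⟩
  refine ⟨hbij, fun r => ?_⟩
  obtain ⟨r', rfl⟩ := hbij.2 r
  refine ⟨r', fun m n A => rfl, fun r'' h => hbij.1 ?_⟩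
  ext m n A
  exact h m n A
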